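/- **Conventions.** $\mathbb N=\{1,2,\dots\}$; $c_{00}$ is the space of finitely supported real sequences on $\mathbb N$ (both vectors and functionals), $f(x)=\sum_k f(k)x(k)$, $e_k=e_k^*$ are the unit vectors, $\operatorname{ran} f$ is the smallest interval containing $\operatorname{supp} f$, and $f<g$ means $\max\operatorname{supp}f<\min\operatorname{supp}g$ (vacuous if a support is empty); a sequence is successive (a block sequence) if $f_i<f_k$ for $i<k$. For $g\in c_{00}$, $\widehat g=\sum_i g(i)e_{2i}$; $f|_{ev}$ is the restriction of $f$ to the even integers. Let $m_0=2$, $m_{j+1}=m_j^5$, $n_0=4$, $n_{j+1}=(12n_j)^{s_j}$, where $2^{s_j}\ge m_{j+1}^3$. An $(\mathcal A_a,\theta)$-operation on a set $S\subset c_{00}$ produces $\theta(f_1+\dots+f_d)$ from successive $f_1<\dots<f_d$ in $S$, $1\le d\le a$. The norming set of $T[(\mathcal A_{a_j},m_j^{-1})_{j\ge0}]$ is the smallest subset of $c_{00}$ that contains all $\pm e_k^*$, is closed under the $(\mathcal A_{a_j},m_j^{-1})$-operations, is symmetric, and is closed under restriction to intervals and under rational convex combinations. A tree analysis of an element $h$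 of it is a finite tree $(h_t)$ of functionals with root $h$, whose leaves are of the form $\pm e_k^*$ and in which every other node is either the result of an $(\mathcal A_{a_j},m_j^{-1})$-operation on its immediate successors (a weighted node, $w(h_t)=m_j$) or a rational convex combination of them. $W_{aux2}$ is the norming set of $T[(\mathcal A_{12n_j},m_j^{-1})_{j\ge 0}]$, and $h\in W_{aux2}$ has $w(h)=m_i$ if $h$ is the result of an $(\mathcal A_{12n_i},m_i^{-1})$-operation on $W_{aux2}$. $W_{mT}$ is the norming set obtained with $a_j=n_j$ for even $j$ and $a_j=2n_j$ for odd $j$. **The set $W_{hi}$.** Fix disjoint infinite sets $\Omega_1,\Omega_2$ of non-negative integers. Let $\mathbb Q_s$ be the set of nonempty finite successive sequences of nonzero elements of $c_{00}$ with rational coordinates, and fix an injection $\sigma:\mathbb Q_s\to\{2j:j\in\Omega_2\}$ with $m_{\sigma(f_1,\dots,f_l)}>\max\{1/|f_i(k)|:k\in\operatorname{supp}f_i,\ i\le l\}\cdot\max\operatorname{supp}f_l$. For $j\ge1$, a $(2j-1)$-special sequence of a set $S$ is a successive sequence $(g_1,\dots,g_p)$ of nonzero elements of $S$ with rational coordinates,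 $p\le n_{2j-1}$, such that $w(g_1)=m_{2j_1}$ with $j_1\in\Omega_1$, $m_{2j_1}\ge n_{2j-1}^2$, and $w(g_{i+1})=m_{\sigma(g_1,\dots,g_i)}$; here $w(g)=m_i$ means that $g$ is the result of an $(\mathcal A_{n_i},m_i^{-1})$-operation on $S$. (The empty sequence is allowed where it appears as a part of other sequences.) $W_{hi}$ is the smallest subset of $c_{00}$ that contains all $\pm e_k^*$, is closed under the $(\mathcal A_{n_{2j}},m_{2j}^{-1})$-operations ($j\ge0$), contains $m_{2j-1}^{-1}\sum_i g_i$ for each of its nonempty $(2j-1)$-special sequences ($j\ge1$), is symmetric, and is closed under restriction to intervals and rational convex combinations. **The set $W_{ex}$.** For $i\ge0$ let $K^{2i}=\{m_{2i}^{-1}\sum_{k\in F}e_k^*:\#F=n_{2i}\}$ and fix pairwise disjoint $K^{2i}_k\subset K^{2i}$, $k\ge1$, each containing functionals with arbitrarily large minimum of the support. Put $W_0=\{\pm e_k^*\}$. Given $W_{N-1}$, $N\ge 1$, let $U_N$ be the set of results of $(\mathcal A_{n_{2j}},m_{2j}^{-1})$-operations on $W_{N-1}$, $j\ge0$; $V_N=(U_N\setminus\bigcup_{i\ge0}\bigcup_{k>N}\widehat{K^{2i}_k})\cup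 W_{N-1}$; $D_N=V_N\setminus W_{N-1}$; $L^{2i}_N$ the set of $f\in D_N$ supported in the odd integers that are the result of an $(\mathcal A_{n_{2i}},m_{2i}^{-1})$-operation on $W_{mT}$. Fix injections $\varrho^{2i}_N:L^{2i}_N\to K^{2i}_N$ with $f<\widehat{\varrho^{2i}_N(f)}$. At level $N$ (for given $j\ge 1$): * a *paired special sequence* is a block sequence $(f_1,\widehat g_1,\dots,f_p,\widehat g_p)$, $p\le n_{2j-1}$, such that $(g_1,\dots,g_p)$ is a $(2j-1)$-special sequence of $W_{hi}$ and for every $k$, with $w(g_k)=m_{2j_k}$, there is $i_k\le N$ with $f_k\in V_N\cap L^{2j_k}_{i_k}$, $g_k=\varrho^{2j_k}_{i_k}(f_k)$ (the pair has weight $m_{2j_k}$); * a *semi-paired special sequence* is a block sequence $(f_1,\widehat g_1,\dots,f_l,\widehat g_l,\widehat g_{l+1},\dots,\widehat g_p)$, $0\le l\le p\le n_{2j-1}$, such that the part up to $\widehat g_l$ is paired special, $(g_1,\dots,g_p)$ is a $(2j-1)$-special sequence of $W_{hi}$, for $k>l$, with $w(g_k)=m_{2j_k}$, $g_k\in\bigcup_{i\le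 N}K^{2j_k}_i$, and, if $l<p$, for no $\phi\in V_N$ is $(f_1,\widehat g_1,\dots,f_l,\widehat g_l,\phi,\widehat g_{l+1})$ paired special; * a *$(2j-1)$-special sequence* is a block sequence $(f_1,\widehat g_1,\dots,f_l,\widehat g_l,\widehat g_{l+1},\dots,\widehat g_q,h_{q+1},\dots,h_p)$, $0\le l\le q\le p\le n_{2j-1}$, such that the part up to $\widehat g_q$ is semi-paired special, $h_r\in V_N$ and $h_r|_{ev}=\widehat\phi_r$ for all $r>q$, where $(g_1,\dots,g_q,\phi_{q+1},\dots,\phi_p)$ is a $(2j-1)$-special sequence of $W_{hi}$, and $h_{q+1}|_{ev}\notin\bigcup_{i\ge0}\bigcup_{k\le N}\widehat{K^{2i}_k}$ if $q<p$. $W_N^{2j-1}$ is the set of all $m_{2j-1}^{-1}\sum(\text{terms})$ over nonempty $(2j-1)$-special sequences at level $N$. $W_N$ is the set of rational convex combinations of the functionals $\pm Ef$, $f\in V_N\cup\bigcup_{j\ge1}W_N^{2j-1}$, $E$ an interval; $W_{ex}=\bigcup_N W_N$, and $\|x\|=\sup\{f(x):f\in W_{ex}\}$. A functional $f\in W_{ex}$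 is weighted with $w(f)=m_i$ if $i$ is even and $f$ is the result of an $(\mathcal A_{n_i},m_i^{-1})$-operation on $W_{ex}$, or $i=2j-1$ and $f=\pm E\phi$ with $E$ an interval and $\phi\in\bigcup_{N\ge1} W^{2j-1}_N$. **Dependent paired sequences.** A block sequence $(y_k)_{k=1}^d$ of nonzero vectors of $c_{00}$ is a $(C,\varepsilon)$-RIS if there are positive integers $t_1<\dots<t_d$ with $\|y_k\|\le C$, $m_{t_{k+1}}^{-1}\#\operatorname{supp}y_k\le\varepsilon$ for $k<d$, and $|f(y_k)|\le C/m_i$ whenever $f\in W_{ex}$, $w(f)=m_i$, $i<t_k$. A vector $x$ is a $C$-$\ell_1^d$-average if $x=\frac1d\sum_{i=1}^d x_i$ with $x_1<\dots<x_d$ and $\|x_i\|\le C\|x\|$. For $C\ge1$, $q\ge2$, $(x,f)$ is a $(C,q)$-standard exact pair if there are a $(C,m_q^{-2})$-RIS $(y_k)_{k=1}^{n_q}$ and $\phi_k\in W_{ex}$ with $x=\frac{m_q}{n_q}\sum_k y_k$, $f=m_q^{-1}\sum_k\phi_k$, $\phi_k(y_k)=1$, $\operatorname{ran}\phi_k=\operatorname{ran}y_k$,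 and indices $l_k$ such that $y_k$ is a $C$-$\ell_1^{n_{l_k}}$-average and $n_q^2<m_{l_1}$. For $j\ge1$, $(x_k,f_k)_{k=1}^{2n_{2j-1}}$ is a $(C,2j-1)$-dependent paired sequence if there are $j_k$, $k\le n_{2j-1}$, such that (1) $x_{2k}=\frac{m_{2j_k}}{n_{2j_k}}\sum_{i\in F_k}e_i$ and $f_{2k}=m_{2j_k}^{-1}\sum_{i\in F_k}e_i^*$ for some set $F_k$ of even integers with $\#F_k=n_{2j_k}$; (2) $(x_{2k-1},f_{2k-1})$ is a $(C,2j_k)$-standard exact pair and $\operatorname{supp}f_{2k-1}$ consists of odd integers; (3) $(f_i)_{i=1}^{2n_{2j-1}}$ is a $(2j-1)$-special sequence at some level $N\ge 1$, the weight of its $k$-th pair being $m_{2j_k}$. **Proposition (a variant of the basic inequality).** Let $(x_k,f_k)_{k=1}^{2n_{2j-1}}$ be a $(C,2j-1)$-dependent paired sequence and $\lambda_k$, $k\le 2n_{2j-1}$, real scalars. Then for every weighted functional $f\in W_{ex}$ there are $g_1,g_2\in c_{00}$ with non-negative coordinates such that $\|g_2\|_\infty<m_{2j-1}^{-3}$ and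 $g_1=h_1$, or $g_1=e_k^*+h_1$ with $k\notin\operatorname{supp}h_1$, or $g_1=e_k^*+e_{k+1}^*+h_1$ with $k,k+1\notin\operatorname{supp}h_1$, for some $h_1\in W_{aux2}$ with $w(h_1)=w(f)$, satisfying $$\Big|f\Big(\sum_{k=1}^{2n_{2j-1}}\lambda_kx_k\Big)\Big|\le C\,(g_1+g_2)\Big(\sum_{k=1}^{2n_{2j-1}}|\lambda_k|e_k\Big).$$ If in addition $j_0\ge 0$ is such that for all weighted $g\in W_{ex}$ with $w(g)=m_{j_0}$ and every interval $E\subset\{1,\dots,2n_{2j-1}\}$ $$\Big|g\Big(\sum_{k\in E}\lambda_kx_k\Big)\Big|\le C\Big(\max_{k\in E}|\lambda_k|+m_{2j-1}^{-3}\sum_{k\in E}|\lambda_k|\Big),$$ then, if $w(f)\ne m_{j_0}$, $h_1$ may moreover be selected to have a tree analysis $(h_t)_{t\in\mathcal T}$ with weighted root of weight $w(f)$ and with $w(h_t)\ne m_{j_0}$ for every weighted node $h_t$. -/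

import Mathlib

open scoped NNReal

noncomputable section

namespace HIExt

/-! ### Finitely supported sequences indexed by the positive integers -/

/-- `c₀₀(ℕ)`, with `ℕ = {1, 2, …}`.  Both vectors and functionals live here. -/
abbrev C00 : Type := ℕ+ →₀ ℝ

/-- The unit vector `e_k` (also `e_k^*`). -/
def e (k : ℕ+) : C00 := Finsupp.single k 1

/-- The action `f(x) = ∑ f(k) x(k)`. -/
def pair (f x : C00) : ℝ := f.sum fun k a => a * x k

/-- `supp f < supp g`. -/
def Before (f g : C00) : Prop := ∀ a ∈ f.support, ∀ b ∈ g.support, a < b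

/-- The range of `f`: the smallest interval containing its support. -/
def ran (f : C00) : Set ℕ+ := {k | ∃ a ∈ f.support, ∃ b ∈ f.support, a ≤ k ∧ k ≤ b}

/-- The restriction `E f` of `f` to the interval `E = [a, b]` (empty if `b < a`). -/
def restrict (a b : ℕ+) (f : C00) : C00 := f.filter fun k => a ≤ k ∧ k ≤ b

/-- The restriction of `f` to the even integers. -/
def evenPart (f : C00) : C00 := f.filter fun k => Even (k : ℕ)

/-- `f` is supported in the odd integers. -/
def OddSupported (f : C00) : Prop := ∀ k ∈ f.support, Odd (k : ℕ)

/-- `ĝ = ∑ g(i) e_{2i}`. -/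
def hat (g : C00) : C00 := g.mapDomain fun k => 2 * k

/-- The set of rational convex combinations of elements of `S`. -/
def convQ (S : Set C00) : Set C00 :=
  {f | ∃ (d : ℕ) (r : Fin d → ℚ) (g : Fin d → C00),
    (∀ i, 0 ≤ r i) ∧ ∑ i, r i = 1 ∧ (∀ i, g i ∈ S) ∧ f = ∑ i, (r i : ℝ) • g i}

/-- The set `{± E f : f ∈ S, E an interval}`. -/
def signedRestrictions (S : Set C00) : Set C00 :=
  {g | ∃ f ∈ S, ∃ a b, g = restrict a b f ∨ g = -restrict a b f}

/-- `(f₁, g₁, …, f_l, g_l, g_{l+1}, …)`. -/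
def interleave : List C00 → List C00 → List C00
  | [], gs => gs
  | fs, [] => fs
  | f :: fs, g :: gs => f :: g :: interleave fs gs

/-- `f` is the result of the `(𝒜_a, θ)`-operation on elements of `S`:
`f = θ (f₁ + ⋯ + f_d)` with `1 ≤ d ≤ a`, `f_i ∈ S` and `f₁ < ⋯ < f_d`. -/
def IsOp (S : Set C00) (a : ℕ) (θ : ℝ) (f : C00) : Prop :=
  ∃ (d : ℕ) (g : Fin d → C00), 1 ≤ d ∧ d ≤ a ∧ (∀ i, g i ∈ S) ∧
    (∀ i k, i < k → Before (g i) (g k)) ∧ f = θ • ∑ i, g i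

/-- `{± e_n^*}`. -/
def unitFunctionals : Set C00 := {f | ∃ k, f = e k ∨ f = -e k}

/-- The norm `‖x‖_W = sup {f(x) : f ∈ W}` induced by a norming set `W`. -/
def normBy (W : Set C00) (x : C00) : ℝ := sSup ((fun f => pair f x) '' W)

/-! ### The sequences `m_j`, `n_j` and mixed Tsirelson norming sets -/

/-- `m₀ = 2`, `m_{j+1} = m_j ^ 5`. -/
def m : ℕ → ℕ
  | 0 => 2
  | j + 1 => m j ^ 5

/-- `n₀ = 4`, `n_{j+1} = (12 n_j) ^ s_j`. -/
def nSeq (s : ℕ → ℕ) : ℕ → ℕ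
  | 0 => 4
  | j + 1 => (12 * nSeq s j) ^ s j

/-- The closure properties of the norming set of `T[(𝒜_{a_j}, m_j⁻¹)_{j ≥ 0}]`. -/
structure IsMTClosed (a : ℕ → ℕ) (S : Set C00) : Prop where
  unit : unitFunctionals ⊆ S
  op : ∀ j f, IsOp S (a j) (m j : ℝ)⁻¹ f → f ∈ S
  neg : ∀ f ∈ S, -f ∈ S
  restrict : ∀ f ∈ S, ∀ p q, restrict p q f ∈ S
  conv : convQ S ⊆ S

/-- The norming set of the mixed Tsirelson space `T[(𝒜_{a_j}, m_j⁻¹)_{j ≥ 0}]`. -/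
def normingSet (a : ℕ → ℕ) : Set C00 := ⋂₀ {S | IsMTClosed a S}

/-- Finite trees of functionals: leaves, results of an operation with weight `m_j`, and rational
convex combinations. -/
inductive FTree : Type
  | leaf (f : C00) : FTree
  | op (j : ℕ) {d : ℕ} (child : Fin d → FTree) : FTree
  | conv {d : ℕ} (r : Fin d → ℚ) (child : Fin d → FTree) : FTree

/-- The functional at the root. -/
def FTree.value : FTree → C00
  | .leaf f => f
  | .op j child => (m j : ℝ)⁻¹ • ∑ i, (child i).value
  | .conv r child => ∑ i, (r i : ℝ) • (child i).value

/-- The tree is a tree analysis of its root functional, with respect to the operations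
`(𝒜_{a_j}, m_j⁻¹)`. -/
def FTree.IsAnalysis (a : ℕ → ℕ) : FTree → Prop
  | .leaf f => f ∈ unitFunctionals
  | @FTree.op j d child => 1 ≤ d ∧ d ≤ a j ∧
      (∀ i k, i < k → Before (child i).value (child k).value) ∧ ∀ i, (child i).IsAnalysis a
  | .conv r child => (∀ i, 0 ≤ r i) ∧ ∑ i, r i = 1 ∧ ∀ i, (child i).IsAnalysis a

/-- The indices `j` of the weights `m_j` of the weighted nodes of the tree. -/
def FTree.weights : FTree → Set ℕ
  | .leaf _ => ∅
  | .op j child => insert j (⋃ i, (child i).weights)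
  | .conv _ child => ⋃ i, (child i).weights

/-! ### The choices entering the construction -/

/-- `K^{2i}`: the functionals `m_{2i}⁻¹ ∑_{k ∈ F} e_k^*` with `#F = n_{2i}`. -/
def Kfull (n : ℕ → ℕ) (i : ℕ) : Set C00 :=
  {g | ∃ F : Finset ℕ+, F.card = n (2 * i) ∧ g = (m (2 * i) : ℝ)⁻¹ • ∑ k ∈ F, e k}

/-- `ℚ_s`: the finite sequences of nonzero successive functionals with rational coordinates. -/
def Qs : Set (List C00) :=
  {L | L ≠ [] ∧ (∀ f ∈ L, f ≠ 0 ∧ ∀ k, ∃ q : ℚ, f k = q) ∧ L.Pairwise Before}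

/-- The objects that are chosen in the construction. -/
structure Choices where
  /-- the exponents `s_j` -/
  s : ℕ → ℕ
  /-- the set `Ω₁` -/
  Ω₁ : Set ℕ
  /-- the set `Ω₂` -/
  Ω₂ : Set ℕ
  /-- the coding function `σ`; only its values on `ℚ_s` matter -/
  σ : List C00 → ℕ
  /-- `K k i` is the set `K_k^{2i}`, for `k ≥ 1` and `i ≥ 0` -/
  K : ℕ → ℕ → Set C00
  /-- `ρ k i` is the coding function `ϱ_k^{2i}`; only its values on `L_k^{2i}` matter -/
  ρ : ℕ → ℕ → C00 → C00

namespace Choices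

variable (P : Choices)

/-- The sequence `n_j`. -/
def n : ℕ → ℕ := nSeq P.s

/-! ### The norming set `W_hi` -/

/-- `(g₁, …, g_p)` is a `(2j-1)`-special sequence of elements of `S`, where `g_{k+1}` has weight
`m_{c k}` (positions are counted from `0`). -/
def IsSpecialIn (S : Set C00) (j : ℕ) (c : ℕ → ℕ) (gs : List C00) : Prop :=
  gs.length ≤ P.n (2 * j - 1) ∧
  (gs ≠ [] → gs ∈ Qs) ∧
  (∀ k g, gs[k]? = some g → g ∈ S ∧ IsOp S (P.n (c k)) (m (c k) : ℝ)⁻¹ g) ∧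
  (gs ≠ [] → ∃ j₁ ∈ P.Ω₁, c 0 = 2 * j₁ ∧ P.n (2 * j - 1) ^ 2 ≤ m (2 * j₁)) ∧
  (∀ k, k + 1 < gs.length → c (k + 1) = P.σ (gs.take (k + 1)))

/-- The closure properties defining `W_hi`. -/
structure IsHiClosed (S : Set C00) : Prop where
  unit : unitFunctionals ⊆ S
  even_op : ∀ j f, IsOp S (P.n (2 * j)) (m (2 * j) : ℝ)⁻¹ f → f ∈ S
  special : ∀ j c gs, 1 ≤ j → gs ≠ [] → P.IsSpecialIn S j c gs →
    (m (2 * j - 1) : ℝ)⁻¹ • gs.sum ∈ S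
  neg : ∀ f ∈ S, -f ∈ S
  restrict : ∀ f ∈ S, ∀ p q, restrict p q f ∈ S
  conv : convQ S ⊆ S

/-- The norming set `W_hi`. -/
def Whi : Set C00 := ⋂₀ {S | P.IsHiClosed S}

/-! ### The norming set `W_ex` -/

/-- The sizes of the families used by the ambient mixed Tsirelson space: `n_i` for even `i` and
`2 n_i` for odd `i`. -/
def ambientSize (i : ℕ) : ℕ := if Even i then P.n i else 2 * P.n i

/-- The norming set `W_mT` of the ambient mixed Tsirelson space. -/
def WmT : Set C00 := normingSet P.ambientSize

/-- `(f₁, ĝ₁, …, f_p, ĝ_p)` is a `(2j-1, V, (ϱ_k^{2i})_{k ≤ N})`-paired special sequence, the weight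
of the pair number `k` (counted from `0`) being `m_{c k}`.  Here `L k i` stands for the domain
`L_k^{2i}` of `ϱ_k^{2i}`. -/
def IsPaired (V : Set C00) (L : ℕ → ℕ → Set C00) (N j : ℕ) (c : ℕ → ℕ) (fs gs : List C00) :
    Prop :=
  fs.length = gs.length ∧ gs.length ≤ P.n (2 * j - 1) ∧
  (interleave fs (gs.map hat)).Pairwise Before ∧
  (∀ k f g, fs[k]? = some f → gs[k]? = some g →
    ∃ i a, c k = 2 * i ∧ 1 ≤ a ∧ a ≤ N ∧ f ∈ V ∩ L a i ∧ g = P.ρ a i f) ∧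
  P.IsSpecialIn P.Whi j c gs

/-- `(f₁, ĝ₁, …, f_l, ĝ_l, ĝ_{l+1}, …, ĝ_p)` is a semi-paired special sequence. -/
def IsSemiPaired (V : Set C00) (L : ℕ → ℕ → Set C00) (N j : ℕ) (c : ℕ → ℕ) (fs gs : List C00) :
    Prop :=
  fs.length ≤ gs.length ∧ gs.length ≤ P.n (2 * j - 1) ∧
  (interleave fs (gs.map hat)).Pairwise Before ∧
  P.IsPaired V L N j c fs (gs.take fs.length) ∧
  (∀ k g, fs.length ≤ k → gs[k]? = some g →
    ∃ i a, c k = 2 * i ∧ 1 ≤ a ∧ a ≤ N ∧ g ∈ P.K a i) ∧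
  P.IsSpecialIn P.Whi j c gs ∧
  (fs.length < gs.length →
    ¬ ∃ φ ∈ V, P.IsPaired V L N j c (fs ++ [φ]) (gs.take (fs.length + 1)))

/-- `F = (f₁, ĝ₁, …, f_l, ĝ_l, ĝ_{l+1}, …, ĝ_q, h_{q+1}, …, h_p)` is a
`(2j-1, V, (ϱ_k^{2i})_{k ≤ N})`-special sequence; `φs` lists the `φ_r ∈ W_hi` for which `φ̂_r` is
the restriction of `h_r` to the even integers. -/
def IsSpecial (V : Set C00) (L : ℕ → ℕ → Set C00) (N j : ℕ) (c : ℕ → ℕ) (F : List C00) : Prop :=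
  ∃ fs gs hs φs : List C00,
    F = interleave fs (gs.map hat) ++ hs ∧ F.Pairwise Before ∧
    gs.length + hs.length ≤ P.n (2 * j - 1) ∧
    P.IsSemiPaired V L N j c fs gs ∧
    (∀ h ∈ hs, h ∈ V) ∧
    (∀ h, hs.head? = some h →
      ∀ i a, 1 ≤ a → a ≤ N → evenPart h ∉ hat '' P.K a i) ∧
    hs.map evenPart = φs.map hat ∧
    P.IsSpecialIn P.Whi j c (gs ++ φs)

/-- `V_N`, as a function of `W = W_{N-1}`. -/
def nextV (N : ℕ) (W : Set C00) : Set C00 :=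
  ({f | ∃ j, IsOp W (P.n (2 * j)) (m (2 * j) : ℝ)⁻¹ f} \
    {f | ∃ i a, N + 1 ≤ a ∧ f ∈ hat '' P.K a i}) ∪ W

/-- `L_N^{2i}`, as a function of `W = W_{N-1}`: the functionals of `D_N = V_N \ W_{N-1}` of weight
`m_{2i}` that are supported in the odd integers. -/
def nextL (N : ℕ) (W : Set C00) (i : ℕ) : Set C00 :=
  {f | f ∈ P.nextV N W \ W ∧ IsOp P.WmT (P.n (2 * i)) (m (2 * i) : ℝ)⁻¹ f ∧ OddSupported f}

/-- The special functionals `W_N^{2j-1}`, as a function of `V = V_N` and of the sets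
`L k i = L_k^{2i}`. -/
def specialFunctionals (N : ℕ) (V : Set C00) (L : ℕ → ℕ → Set C00) (j : ℕ) : Set C00 :=
  {φ | ∃ c F, F ≠ [] ∧ P.IsSpecial V L N j c F ∧ φ = (m (2 * j - 1) : ℝ)⁻¹ • F.sum}

/-- The inductive construction: stage `N` consists of `W_N` and of the sets
`L_k^{2i}`, `1 ≤ k ≤ N`. -/
def stage : ℕ → Set C00 × (ℕ → ℕ → Set C00)
  | 0 => (unitFunctionals, fun _ _ => ∅)
  | N + 1 =>
    let W := (stage N).1
    let V := P.nextV (N + 1) W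
    let L : ℕ → ℕ → Set C00 := fun k i =>
      if k = N + 1 then P.nextL (N + 1) W i else (stage N).2 k i
    (convQ (signedRestrictions
      (V ∪ {φ | ∃ j, 1 ≤ j ∧ φ ∈ P.specialFunctionals (N + 1) V L j})), L)

/-- `W_N`. -/
def W (N : ℕ) : Set C00 := (P.stage N).1

/-- `V_N`, for `N ≥ 1`. -/
def V (N : ℕ) : Set C00 := P.nextV N (P.W (N - 1))

/-- `L_k^{2i}`, for `k ≥ 1`. -/
def L (k i : ℕ) : Set C00 := P.nextL k (P.W (k - 1)) i

/-- The norming set `W_ex`. -/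
def Wex : Set C00 := ⋃ N, P.W N

/-- The conditions under which the choices are made. -/
structure Valid : Prop where
  s_large : ∀ j, m (j + 1) ^ 3 ≤ 2 ^ P.s j
  Ω₁_infinite : P.Ω₁.Infinite
  Ω₂_infinite : P.Ω₂.Infinite
  Ω_disjoint : Disjoint P.Ω₁ P.Ω₂
  σ_mem : ∀ F ∈ Qs, ∃ j ∈ P.Ω₂, P.σ F = 2 * j
  σ_inj : Set.InjOn P.σ Qs
  /-- `m_{σ(f₁,…,f_l)} > max {1 / |f_i(e_k)| : k ∈ supp f_i, i ≤ l} · max supp f_l` -/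
  σ_large : ∀ F ∈ Qs, ∀ f ∈ F, ∀ k ∈ f.support, ∀ g, F.getLast? = some g → ∀ b ∈ g.support,
    1 / |f k| * ((b : ℕ) : ℝ) < m (P.σ F)
  K_subset : ∀ k i, 1 ≤ k → P.K k i ⊆ Kfull P.n i
  K_disjoint : ∀ i k l, 1 ≤ k → 1 ≤ l → k ≠ l → Disjoint (P.K k i) (P.K l i)
  K_unbounded : ∀ k i, 1 ≤ k → ∀ b : ℕ+, ∃ g ∈ P.K k i, ∀ a ∈ g.support, b < a
  ρ_mem : ∀ k i, 1 ≤ k → Set.MapsTo (P.ρ k i) (P.L k i) (P.K k i)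
  ρ_inj : ∀ k i, 1 ≤ k → Set.InjOn (P.ρ k i) (P.L k i)
  ρ_after : ∀ k i, 1 ≤ k → ∀ f ∈ P.L k i, Before f (hat (P.ρ k i f))

/-! ### Weighted functionals, rapidly increasing sequences, exact pairs -/

/-- `f ∈ W_ex` is weighted with `w(f) = m_i`: for even `i` it is the result of an
`(𝒜_{n_i}, m_i⁻¹)`-operation on elements of `W_ex`, for odd `i = 2j-1` it is, up to the sign, the
restriction to an interval of a `(2j-1)`-special functional. -/
def HasWeight (f : C00) (i : ℕ) : Prop :=
  f ∈ P.Wex ∧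
  ((Even i ∧ IsOp P.Wex (P.n i) (m i : ℝ)⁻¹ f) ∨
    ∃ j N, 1 ≤ j ∧ 1 ≤ N ∧ i = 2 * j - 1 ∧
      f ∈ signedRestrictions (P.specialFunctionals N (P.V N) P.L j))

/-- `x` is a `C-ℓ₁^d` average in `X_ex`. -/
def IsL1Average (C : ℝ) (d : ℕ) (x : C00) : Prop :=
  ∃ y : Fin d → C00, (∀ i k, i < k → Before (y i) (y k)) ∧
    x = (d : ℝ)⁻¹ • ∑ i, y i ∧ ∀ i, normBy P.Wex (y i) ≤ C * normBy P.Wex x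

/-- The finite block sequence `y` is a `(C, ε)`-rapidly increasing sequence in `X_ex`. -/
def IsRIS (C ε : ℝ) {d : ℕ} (y : Fin d → C00) : Prop :=
  (∀ k, y k ≠ 0) ∧ (∀ k l, k < l → Before (y k) (y l)) ∧
  ∃ t : Fin d → ℕ, StrictMono t ∧ (∀ k, 1 ≤ t k) ∧
    (∀ k, normBy P.Wex (y k) ≤ C) ∧
    (∀ k l : Fin d, (l : ℕ) = k + 1 → (m (t l) : ℝ)⁻¹ * (y k).support.card ≤ ε) ∧
    (∀ k f i, i < t k → P.HasWeight f i → |pair f (y k)| ≤ C / m i)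

/-- `(x, f)` is a `(C, q)`-standard exact pair. -/
def IsSEP (C : ℝ) (q : ℕ) (x f : C00) : Prop :=
  1 ≤ C ∧ 2 ≤ q ∧
  ∃ y φ : Fin (P.n q) → C00,
    P.IsRIS C ((m q : ℝ)⁻¹ ^ 2) y ∧
    x = ((m q : ℝ) / P.n q) • ∑ k, y k ∧
    f = (m q : ℝ)⁻¹ • ∑ k, φ k ∧
    (∀ k, φ k ∈ P.Wex ∧ pair (φ k) (y k) = 1 ∧ ran (φ k) = ran (y k)) ∧
    ∃ l : Fin (P.n q) → ℕ, (∀ k, P.IsL1Average C (P.n (l k)) (y k)) ∧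
      ∀ k : Fin (P.n q), (k : ℕ) = 0 → P.n q ^ 2 < m (l k)

/-- `(x_k, f_k)_{k=1}^{2 n_{2j-1}}` is a `(C, 2j-1)`-dependent paired sequence.  Positions are
counted from `0`: `x_{2k-1}, x_{2k}`, `1 ≤ k ≤ n_{2j-1}`, are `x (2 * k), x (2 * k + 1)`,
`0 ≤ k < n_{2j-1}`. -/
def IsDependentPaired (C : ℝ) (j : ℕ) (x f : ℕ → C00) : Prop :=
  ∃ t : ℕ → ℕ,
    (∀ k < P.n (2 * j - 1),
      (∃ F : Finset ℕ+, F.card = P.n (2 * t k) ∧ (∀ i ∈ F, Even (i : ℕ)) ∧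
        x (2 * k + 1) = ((m (2 * t k) : ℝ) / P.n (2 * t k)) • ∑ i ∈ F, e i ∧
        f (2 * k + 1) = (m (2 * t k) : ℝ)⁻¹ • ∑ i ∈ F, e i) ∧
      P.IsSEP C (2 * t k) (x (2 * k)) (f (2 * k)) ∧ OddSupported (f (2 * k))) ∧
    ∃ N, 1 ≤ N ∧
      P.IsSpecial (P.V N) P.L N j (fun k => 2 * t k)
        ((List.range (2 * P.n (2 * j - 1))).map f)

/-! ### The auxiliary space -/

/-- The norming set `W_aux2` of `T[(𝒜_{12 n_j}, m_j⁻¹)_j]`. -/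
def Waux2 : Set C00 := normingSet fun i => 12 * P.n i

/-- `g₁, g₂, h₁` majorize the action of the weight-`m_i` functional `φ` on
`∑_{k ≤ 2 n_{2j-1}} λ_k x_k` in the way required by the basic inequality. -/
def IsMajorant (C : ℝ) (j : ℕ) (x : ℕ → C00) (lam : ℕ → ℝ) (φ : C00) (i : ℕ)
    (g₁ g₂ h₁ : C00) : Prop :=
  (∀ k, 0 ≤ g₁ k) ∧ (∀ k, 0 ≤ g₂ k) ∧
  (∀ k, |g₂ k| < (m (2 * j - 1) : ℝ)⁻¹ ^ 3) ∧
  h₁ ∈ P.Waux2 ∧ IsOp P.Waux2 (12 * P.n i) (m i : ℝ)⁻¹ h₁ ∧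
  (g₁ = h₁ ∨
    (∃ k, k ∉ h₁.support ∧ g₁ = e k + h₁) ∨
    ∃ k, k ∉ h₁.support ∧ k + 1 ∉ h₁.support ∧ g₁ = e k + e (k + 1) + h₁) ∧
  |pair φ (∑ k ∈ Finset.range (2 * P.n (2 * j - 1)), lam k • x k)| ≤
    C * pair (g₁ + g₂)
      (∑ k ∈ Finset.range (2 * P.n (2 * j - 1)), |lam k| • e k.succPNat)

end Choices

end HIExt

end

namespace HIExt

/-! ### The pairing -/

theorem pair_eq_linearCombination (f x : C00) : pair f x = Finsupp.linearCombination ℝ (⇑x) f := by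
  simp [pair, Finsupp.linearCombination_apply]

theorem pair_comm (f x : C00) : pair f x = pair x f := by
  have h : ∀ u v : C00, pair u v = ∑ k ∈ u.support ∪ v.support, u k * v k := fun u v =>
    Finsupp.sum_of_support_subset _ Finset.subset_union_left _ (by simp)
  rw [h, h, Finset.union_comm]
  exact Finset.sum_congr rfl fun _ _ => mul_comm _ _

theorem pair_smul_left (a : ℝ) (f x : C00) : pair (a • f) x = a * pair f x := by
  simp [pair_eq_linearCombination]

theorem pair_neg_left (f x : C00) : pair (-f) x = -pair f x := by
  simp [pair_eq_linearCombination]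

theorem pair_zero_left (x : C00) : pair 0 x = 0 := by simp [pair]

theorem pair_sum_left {ι : Type*} (s : Finset ι) (f : ι → C00) (x : C00) :
    pair (∑ i ∈ s, f i) x = ∑ i ∈ s, pair (f i) x := by
  simp [pair_eq_linearCombination]

theorem pair_smul_right (a : ℝ) (f x : C00) : pair f (a • x) = a * pair f x := by
  rw [pair_comm, pair_smul_left, pair_comm]

theorem pair_sum_right {ι : Type*} (s : Finset ι) (f : C00) (x : ι → C00) :
    pair f (∑ i ∈ s, x i) = ∑ i ∈ s, pair f (x i) := by
  rw [pair_comm, pair_sum_left]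
  exact Finset.sum_congr rfl fun _ _ => pair_comm _ _

theorem pair_e_left (k : ℕ+) (x : C00) : pair (e k) x = x k := by simp [pair, e]

theorem pair_e_right (f : C00) (k : ℕ+) : pair f (e k) = f k := by rw [pair_comm, pair_e_left]

theorem pair_eq_zero_of_disjoint {f x : C00} (h : ∀ c ∈ f.support, c ∉ x.support) :
    pair f x = 0 := by
  refine Finset.sum_eq_zero fun c hc => ?_
  simp [Finsupp.notMem_support_iff.1 (h c hc)]

theorem abs_pair_le_card {f x : C00} {A B : ℝ} (hA : ∀ c, |f c| ≤ A) (hB : ∀ c, |x c| ≤ B) :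
    |pair f x| ≤ x.support.card * (A * B) := by
  rw [pair_comm]
  have hA0 : 0 ≤ A := (abs_nonneg _).trans (hA 1)
  calc |pair x f| ≤ ∑ c ∈ x.support, |x c * f c| := Finset.abs_sum_le_sum_abs _ _
    _ ≤ ∑ _c ∈ x.support, A * B := Finset.sum_le_sum fun c _ => by
        rw [abs_mul, mul_comm A]
        exact mul_le_mul (hB c) (hA c) (abs_nonneg _) ((abs_nonneg _).trans (hB c))
    _ = _ := by simp

theorem e_apply_self (k : ℕ+) : e k k = 1 := by simp [e]

theorem e_apply (k l : ℕ+) : e k l = if k = l then 1 else 0 := by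
  rw [e, Finsupp.single_apply]

theorem e_nonneg (k l : ℕ+) : 0 ≤ e k l := by
  rw [e_apply]; split_ifs <;> norm_num

theorem e_support (k : ℕ+) : (e k).support = {k} :=
  Finsupp.support_single _ one_ne_zero

theorem e_ne_zero (k : ℕ+) : e k ≠ 0 := by simp [e]

theorem e_injective : Function.Injective e := fun k l h => by
  have := congrArg Finsupp.support h
  simpa [e_support] using this

/-! ### Restrictions -/

theorem restrict_apply (a b : ℕ+) (f : C00) (k : ℕ+) :
    restrict a b f k = if a ≤ k ∧ k ≤ b then f k else 0 := by
  rw [restrict, Finsupp.filter_apply]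

theorem restrict_neg (a b : ℕ+) (f : C00) : restrict a b (-f) = -restrict a b f :=
  Finsupp.filter_neg _ _

theorem restrict_smul (a b : ℕ+) (r : ℝ) (f : C00) :
    restrict a b (r • f) = r • restrict a b f := Finsupp.filter_smul

theorem restrict_sum {ι : Type*} (a b : ℕ+) (s : Finset ι) (f : ι → C00) :
    restrict a b (∑ i ∈ s, f i) = ∑ i ∈ s, restrict a b (f i) := by
  ext k
  simp [restrict_apply, Finsupp.finsetSum_apply]

theorem restrict_restrict (a b c d : ℕ+) (f : C00) :
    restrict a b (restrict c d f) = restrict (max a c) (min b d) f := by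
  ext k
  simp only [restrict_apply, max_le_iff, le_min_iff]
  split_ifs <;> tauto

theorem restrict_e (a b k : ℕ+) : restrict a b (e k) = if a ≤ k ∧ k ≤ b then e k else 0 := by
  ext l
  rw [restrict_apply, e_apply]
  by_cases h : k = l
  · subst h
    by_cases hc : a ≤ k ∧ k ≤ b
    · simp [hc, e_apply]
    · simp only [if_neg hc, Finsupp.coe_zero, Pi.zero_apply]
  · rw [if_neg h, ite_self]
    split_ifs
    · rw [e_apply, if_neg h]
    · rfl

theorem exists_restrict_eq (f : C00) : ∃ b, restrict 1 b f = f := by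
  obtain ⟨b, hb⟩ := f.support.exists_le
  refine ⟨b, ?_⟩
  ext k
  rw [restrict_apply]
  by_cases hk : k ∈ f.support
  · rw [if_pos ⟨one_le, hb k hk⟩]
  · rw [Finsupp.notMem_support_iff.1 hk, ite_self]

theorem restrict_support_subset (a b : ℕ+) (f : C00) : (restrict a b f).support ⊆ f.support := by
  intro k hk
  rw [Finsupp.mem_support_iff, restrict_apply] at hk
  simp only [ne_eq, ite_eq_right_iff, not_forall] at hk
  exact Finsupp.mem_support_iff.2 hk.2

/-! ### Successive functionals -/

theorem Before.mono {f g f' g' : C00} (h : Before f g) (hf : f'.support ⊆ f.support)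
    (hg : g'.support ⊆ g.support) : Before f' g' := fun a ha b hb => h a (hf ha) b (hg hb)

theorem Before.restrict {f g : C00} (h : Before f g) (a b : ℕ+) :
    Before (restrict a b f) (restrict a b g) :=
  h.mono (restrict_support_subset _ _ _) (restrict_support_subset _ _ _)

theorem Before.neg {f g : C00} (h : Before f g) : Before (-f) (-g) :=
  h.mono (by simp) (by simp)

/-- A sum of successive functionals is bounded by the largest of its terms. -/
theorem abs_sum_apply_le_of_successive {ι : Type*} [LinearOrder ι] {s : Finset ι} {g : ι → C00}
    (hg : ∀ i ∈ s, ∀ k ∈ s, i < k → Before (g i) (g k)) {A : ℝ} (hA : 0 ≤ A) (c : ℕ+)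
    (h : ∀ i ∈ s, |g i c| ≤ A) : |(∑ i ∈ s, g i) c| ≤ A := by
  rw [Finsupp.finsetSum_apply]
  by_cases h0 : ∀ i ∈ s, g i c = 0
  · rw [Finset.sum_eq_zero h0, abs_zero]; exact hA
  · push Not at h0
    obtain ⟨i, hi, hic⟩ := h0
    rw [Finset.sum_eq_single_of_mem i hi]
    · exact h i hi
    · intro k hk hki
      by_contra hkc
      replace hkc := Finsupp.mem_support_iff.2 hkc
      replace hic := Finsupp.mem_support_iff.2 hic
      rcases lt_or_gt_of_ne hki with hlt | hlt
      · exact lt_irrefl _ (hg k hk i hi hlt c hkc c hic)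
      · exact lt_irrefl _ (hg i hi k hk hlt c hic c hkc)

/-- Nonzero pairwise comparable functionals can be listed in increasing order. -/
theorem exists_successive_enumeration (U : Finset C00) (h0 : ∀ u ∈ U, u ≠ 0)
    (hc : ∀ u ∈ U, ∀ v ∈ U, u ≠ v → Before u v ∨ Before v u) :
    ∃ g : Fin U.card → C00, (∀ i, g i ∈ U) ∧ (∀ i k, i < k → Before (g i) (g k)) ∧
      ∑ i, g i = ∑ u ∈ U, u := by
  classical
  have hne : ∀ u ∈ U, u.support.Nonempty := fun u hu => Finsupp.support_nonempty_iff.2 (h0 u hu)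
  let key : U → ℕ+ := fun u => u.1.support.min' (hne u u.2)
  have hkey : ∀ u : U, key u ∈ u.1.support := fun u => Finset.min'_mem _ _
  have hinj : Function.Injective key := by
    intro u v huv
    by_contra hne'
    have hu := hkey u
    have hv := hkey v
    rw [huv] at hu
    rcases hc u u.2 v v.2 (fun h => hne' (Subtype.ext h)) with h | h
    · exact lt_irrefl _ (h _ hu _ hv)
    · exact lt_irrefl _ (h _ hv _ hu)
  let o : Fin U.card ≃ U := (Fintype.equivFinOfCardEq (Fintype.card_coe U)).symm
  let τ := Tuple.sort (key ∘ o)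
  have hmono : Monotone (key ∘ o ∘ τ) := Tuple.monotone_sort (key ∘ o)
  refine ⟨fun i => (o (τ i)).1, fun i => (o (τ i)).2, fun i k hik => ?_, ?_⟩
  · rcases hc _ (o (τ i)).2 _ (o (τ k)).2 (fun h =>
      hik.ne (τ.injective (o.injective (Subtype.ext h)))) with h | h
    · exact h
    · exact absurd (h _ (hkey _) _ (hkey _)) (hmono hik.le).not_gt
  · rw [← Finset.sum_coe_sort U]
    exact Equiv.sum_comp (τ.trans o) fun u : U => u.1

/-! ### The sequences `m_j`, `n_j` -/

theorem m_eq (j : ℕ) : m j = 2 ^ 5 ^ j := by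
  induction j with
  | zero => rfl
  | succ j ih => rw [m, ih, ← pow_mul, pow_succ]

theorem m_pos (j : ℕ) : 0 < m j := by rw [m_eq]; positivity

theorem m_pos_real (j : ℕ) : (0 : ℝ) < m j := Nat.cast_pos.2 (m_pos j)

theorem m_strictMono : StrictMono m := fun i j h => by
  rw [m_eq, m_eq]
  exact Nat.pow_lt_pow_right (by norm_num) (Nat.pow_lt_pow_right (by norm_num) h)

theorem two_le_m (j : ℕ) : 2 ≤ m j := m_strictMono.monotone (Nat.zero_le j)

theorem inv_m_anti {i j : ℕ} (h : i ≤ j) : (m j : ℝ)⁻¹ ≤ (m i : ℝ)⁻¹ :=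
  inv_anti₀ (m_pos_real i) (Nat.cast_le.2 (m_strictMono.monotone h))

theorem inv_m_le_half (j : ℕ) : (m j : ℝ)⁻¹ ≤ 1 / 2 := by
  rw [one_div]
  exact inv_anti₀ two_pos (by exact_mod_cast two_le_m j)

namespace Choices

variable {P : Choices}

theorem Valid.pow_le (hP : P.Valid) (j : ℕ) : 3 * 5 ^ (j + 1) ≤ P.s j := by
  have h := hP.s_large j
  rw [m_eq, ← pow_mul] at h
  have := (Nat.pow_le_pow_iff_right (by norm_num : 1 < 2)).1 h
  omega

theorem four_le_n (P : Choices) (hP : P.Valid) (j : ℕ) : 4 ≤ P.n j := by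
  induction j with
  | zero => exact le_rfl
  | succ j ih =>
    have h1 := hP.pow_le j
    have : 1 ≤ P.s j := le_trans (Nat.succ_le_of_lt (by positivity)) h1
    calc 4 ≤ 12 * P.n j := by omega
      _ = (12 * P.n j) ^ 1 := (pow_one _).symm
      _ ≤ (12 * P.n j) ^ P.s j := Nat.pow_le_pow_right (by omega) this

theorem n_mono (hP : P.Valid) : Monotone P.n := by
  refine monotone_nat_of_le_succ fun j => ?_
  have h1 := hP.pow_le j
  have h4 := four_le_n P hP j
  have : 1 ≤ P.s j := le_trans (Nat.succ_le_of_lt (by positivity)) h1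
  calc P.n j ≤ (12 * P.n j) ^ 1 := by rw [pow_one]; omega
    _ ≤ (12 * P.n j) ^ P.s j := Nat.pow_le_pow_right (by omega) this

theorem pow_le_n_succ (hP : P.Valid) (j : ℕ) : (12 * P.n j) ^ (3 * 5 ^ (j + 1)) ≤ P.n (j + 1) :=
  Nat.pow_le_pow_right (by have := four_le_n P hP j; omega) (hP.pow_le j)

end Choices
end HIExt

namespace HIExt

/-! ### Operations and convex combinations -/

theorem sum_e_apply (F : Finset ℕ+) (c : ℕ+) : (∑ k ∈ F, e k) c = if c ∈ F then 1 else 0 := by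
  classical
  rw [Finsupp.finsetSum_apply]
  simp [e_apply]

theorem subset_convQ (S : Set C00) : S ⊆ convQ S := fun f hf =>
  ⟨1, fun _ => 1, fun _ => f, by simp, by simp, by simpa using hf, by simp⟩

theorem IsOp.mono {S S' : Set C00} {a a' : ℕ} {θ : ℝ} {f : C00} (h : IsOp S a θ f) (hS : S ⊆ S')
    (ha : a ≤ a') : IsOp S' a' θ f := by
  obtain ⟨d, g, h1, h2, h3, h4, h5⟩ := h
  exact ⟨d, g, h1, h2.trans ha, fun i => hS (h3 i), h4, h5⟩

theorem isOp_finset_sum {S : Set C00} {a : ℕ} (θ : ℝ) {U : Finset C00} (hU : U.Nonempty)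
    (ha : U.card ≤ a) (hS : ∀ u ∈ U, u ∈ S) (h0 : ∀ u ∈ U, u ≠ 0)
    (hc : ∀ u ∈ U, ∀ v ∈ U, u ≠ v → Before u v ∨ Before v u) : IsOp S a θ (θ • ∑ u ∈ U, u) := by
  obtain ⟨g, hg, hs, h⟩ := exists_successive_enumeration U h0 hc
  exact ⟨_, g, hU.card_pos, ha, fun i => hS _ (hg i), hs, by rw [h]⟩

theorem before_e {k l : ℕ+} (h : k < l) : Before (e k) (e l) := by
  intro a ha b hb
  rw [e_support, Finset.mem_singleton] at ha hb
  rwa [ha, hb]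

theorem e_comparable {u v : C00} (hu : u ∈ Set.range e) (hv : v ∈ Set.range e) (h : u ≠ v) :
    Before u v ∨ Before v u := by
  obtain ⟨k, rfl⟩ := hu
  obtain ⟨l, rfl⟩ := hv
  rcases lt_trichotomy k l with hkl | rfl | hkl
  · exact .inl (before_e hkl)
  · exact absurd rfl h
  · exact .inr (before_e hkl)

theorem isOp_sum_e {S : Set C00} {a : ℕ} (θ : ℝ) (hS : unitFunctionals ⊆ S) {F : Finset ℕ+}
    (hF : F.Nonempty) (ha : F.card ≤ a) : IsOp S a θ (θ • ∑ k ∈ F, e k) := by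
  classical
  have h := isOp_finset_sum (S := S) (a := a) θ (U := F.image e) (hF.image e)
    (Finset.card_image_le.trans ha)
    (fun u hu => by
      obtain ⟨k, -, rfl⟩ := Finset.mem_image.1 hu
      exact hS ⟨k, .inl rfl⟩)
    (fun u hu => by
      obtain ⟨k, -, rfl⟩ := Finset.mem_image.1 hu
      exact e_ne_zero k)
    (fun u hu v hv => by
      obtain ⟨k, -, rfl⟩ := Finset.mem_image.1 hu
      obtain ⟨l, -, rfl⟩ := Finset.mem_image.1 hv
      exact e_comparable ⟨k, rfl⟩ ⟨l, rfl⟩)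
  rwa [Finset.sum_image fun _ _ _ _ h => e_injective h] at h

theorem exists_abs_pair_le_of_mem_convQ {S : Set C00} {f : C00} (hf : f ∈ convQ S) (x : C00) :
    ∃ g ∈ S, |pair f x| ≤ |pair g x| := by
  obtain ⟨d, r, g, hr, hr1, hg, rfl⟩ := hf
  by_contra! h
  set A := |pair (∑ i, (r i : ℝ) • g i) x| with hA
  have hr1' : ∑ i, (r i : ℝ) = 1 := by exact_mod_cast hr1
  have hr' : ∀ i, (0 : ℝ) ≤ r i := fun i => by exact_mod_cast hr i
  have h1 : A ≤ ∑ i, (r i : ℝ) * |pair (g i) x| := by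
    rw [hA, pair_sum_left]
    refine (Finset.abs_sum_le_sum_abs _ _).trans (Finset.sum_le_sum fun i _ => ?_)
    rw [pair_smul_left, abs_mul, abs_of_nonneg (hr' i)]
  have hpos : ∃ i ∈ Finset.univ, (0 : ℝ) < r i := by
    by_contra! h0
    have : ∑ i, (r i : ℝ) ≤ 0 := Finset.sum_nonpos h0
    linarith
  have h2 : ∑ i, (r i : ℝ) * |pair (g i) x| < ∑ i, (r i : ℝ) * A := by
    refine Finset.sum_lt_sum
      (fun i _ => mul_le_mul_of_nonneg_left (h (g i) (hg i)).le (hr' i)) ?_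
    obtain ⟨i, hi, hpi⟩ := hpos
    exact ⟨i, hi, mul_lt_mul_of_pos_left (h (g i) (hg i)) hpi⟩
  rw [← Finset.sum_mul, hr1', one_mul] at h2
  linarith

theorem neg_mem_signedRestrictions {S : Set C00} {f : C00} (h : f ∈ signedRestrictions S) :
    -f ∈ signedRestrictions S := by
  obtain ⟨g, hg, a, b, rfl | rfl⟩ := h
  · exact ⟨g, hg, a, b, .inr rfl⟩
  · exact ⟨g, hg, a, b, .inl (neg_neg _)⟩

theorem restrict_mem_signedRestrictions {S : Set C00} {f : C00} (h : f ∈ signedRestrictions S)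
    (a b : ℕ+) : restrict a b f ∈ signedRestrictions S := by
  obtain ⟨g, hg, c, d, rfl | rfl⟩ := h
  · exact ⟨g, hg, _, _, .inl (restrict_restrict _ _ _ _ _)⟩
  · exact ⟨g, hg, max a c, min b d, .inr (by rw [restrict_neg, restrict_restrict])⟩

theorem subset_signedRestrictions (S : Set C00) : S ⊆ signedRestrictions S := fun f hf => by
  obtain ⟨b, hb⟩ := exists_restrict_eq f
  exact ⟨f, hf, 1, b, .inl hb.symm⟩

theorem neg_mem_convQ {S : Set C00} (hS : ∀ f ∈ S, -f ∈ S) {f : C00} (h : f ∈ convQ S) :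
    -f ∈ convQ S := by
  obtain ⟨d, r, g, hr, hr1, hg, rfl⟩ := h
  exact ⟨d, r, fun i => -g i, hr, hr1, fun i => hS _ (hg i), by simp⟩

theorem restrict_mem_convQ {S : Set C00} {a b : ℕ+} (hS : ∀ f ∈ S, restrict a b f ∈ S) {f : C00}
    (h : f ∈ convQ S) : restrict a b f ∈ convQ S := by
  obtain ⟨d, r, g, hr, hr1, hg, rfl⟩ := h
  refine ⟨d, r, fun i => restrict a b (g i), hr, hr1, fun i => hS _ (hg i), ?_⟩
  rw [restrict_sum]
  exact Finset.sum_congr rfl fun i _ => restrict_smul _ _ _ _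

theorem mem_interleave {u : C00} : ∀ {fs gs : List C00}, u ∈ interleave fs gs → u ∈ fs ∨ u ∈ gs
  | [], gs, h => .inr (by simpa [interleave] using h)
  | f :: fs, [], h => .inl (by simpa [interleave] using h)
  | f :: fs, g :: gs, h => by
    simp only [interleave, List.mem_cons] at h ⊢
    rcases h with h | h | h
    · exact .inl (.inl h)
    · exact .inr (.inl h)
    · rcases mem_interleave h with h | h
      · exact .inl (.inr h)
      · exact .inr (.inr h)

theorem length_interleave :
    ∀ fs gs : List C00, (interleave fs gs).length = fs.length + gs.length
  | [], gs => by simp [interleave]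
  | f :: fs, [] => by simp [interleave]
  | f :: fs, g :: gs => by
    simp only [interleave, List.length_cons, length_interleave fs gs]
    omega

theorem hat_smul_sum_e (θ : ℝ) (F : Finset ℕ+) :
    hat (θ • ∑ k ∈ F, e k) = θ • ∑ k ∈ F, e (2 * k) := by
  simp [hat, Finsupp.mapDomain_smul, Finsupp.mapDomain_finsetSum, e, Finsupp.mapDomain_single]

theorem hat_injective : Function.Injective hat :=
  Finsupp.mapDomain_injective fun _ _ h => mul_left_cancel h

namespace Choices

variable {P : Choices}

/-! ### The inductive construction of `W_ex` -/

theorem IsPaired.congr {V : Set C00} {L L' : ℕ → ℕ → Set C00} {N j : ℕ} {c : ℕ → ℕ}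
    {fs gs : List C00} (hL : ∀ a i, 1 ≤ a → a ≤ N → L a i = L' a i)
    (h : P.IsPaired V L N j c fs gs) : P.IsPaired V L' N j c fs gs := by
  obtain ⟨h1, h2, h3, h4, h5⟩ := h
  refine ⟨h1, h2, h3, fun k f g hf hg => ?_, h5⟩
  obtain ⟨i, a, hc, ha, haN, hfV, hfg⟩ := h4 k f g hf hg
  exact ⟨i, a, hc, ha, haN, hL a i ha haN ▸ hfV, hfg⟩

theorem IsSpecial.congr {V : Set C00} {L L' : ℕ → ℕ → Set C00} {N j : ℕ} {c : ℕ → ℕ}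
    {F : List C00} (hL : ∀ a i, 1 ≤ a → a ≤ N → L a i = L' a i)
    (h : P.IsSpecial V L N j c F) : P.IsSpecial V L' N j c F := by
  obtain ⟨fs, gs, hs, φs, h1, h2, h3, ⟨s1, s2, s3, s4, s5, s6, s7⟩, h5⟩ := h
  refine ⟨fs, gs, hs, φs, h1, h2, h3, ⟨s1, s2, s3, s4.congr hL, s5, s6, fun hlt => ?_⟩, h5⟩
  rintro ⟨φ, hφ, hp⟩
  exact s7 hlt ⟨φ, hφ, hp.congr fun a i ha haN => (hL a i ha haN).symm⟩

theorem stage_L (P : Choices) (N : ℕ) :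
    ∀ k i, 1 ≤ k → k ≤ N → (P.stage N).2 k i = P.L k i := by
  induction N with
  | zero => intro k i h1 h2; omega
  | succ N ih =>
    intro k i h1 h2
    simp only [stage]
    split_ifs with h
    · subst h; rfl
    · exact ih k i h1 (by omega)

/-- The functionals that generate `W_N`. -/
def generators (P : Choices) (N : ℕ) : Set C00 :=
  P.V N ∪ {φ | ∃ j, 1 ≤ j ∧ φ ∈ P.specialFunctionals N (P.V N) P.L j}

theorem W_succ (P : Choices) (N : ℕ) :
    P.W (N + 1) = convQ (signedRestrictions (P.generators (N + 1))) := by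
  have hL : ∀ a i, 1 ≤ a → a ≤ N + 1 →
      (P.stage (N + 1)).2 a i = P.L a i := fun a i h1 h2 => P.stage_L (N + 1) a i h1 h2
  have : ∀ j, P.specialFunctionals (N + 1) (P.V (N + 1)) (P.stage (N + 1)).2 j =
      P.specialFunctionals (N + 1) (P.V (N + 1)) P.L j := by
    intro j
    ext φ
    constructor
    · rintro ⟨c, F, hF, h, rfl⟩
      exact ⟨c, F, hF, h.congr hL, rfl⟩
    · rintro ⟨c, F, hF, h, rfl⟩
      exact ⟨c, F, hF, h.congr fun a i h1 h2 => (hL a i h1 h2).symm, rfl⟩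
  change convQ (signedRestrictions (P.V (N + 1) ∪ {φ | ∃ j, 1 ≤ j ∧
    φ ∈ P.specialFunctionals (N + 1) (P.V (N + 1)) (P.stage (N + 1)).2 j})) = _
  simp only [this]
  rfl

theorem W_subset_V (P : Choices) (N : ℕ) : P.W N ⊆ P.V (N + 1) := fun _ hf => .inr hf

theorem signedRestrictions_V_subset_W (P : Choices) (N : ℕ) :
    signedRestrictions (P.V (N + 1)) ⊆ P.W (N + 1) := fun f hf => by
  rw [W_succ]
  refine subset_convQ _ ?_
  obtain ⟨g, hg, a, b, h⟩ := hf
  exact ⟨g, .inl hg, a, b, h⟩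

theorem V_subset_W (P : Choices) (N : ℕ) : P.V (N + 1) ⊆ P.W (N + 1) :=
  (subset_signedRestrictions _).trans (P.signedRestrictions_V_subset_W N)

theorem W_mono (P : Choices) : Monotone P.W :=
  monotone_nat_of_le_succ fun N => (P.W_subset_V N).trans (P.V_subset_W N)

theorem W_subset_Wex (P : Choices) (N : ℕ) : P.W N ⊆ P.Wex := Set.subset_iUnion P.W N

theorem unitFunctionals_subset_W (P : Choices) (N : ℕ) : unitFunctionals ⊆ P.W N :=
  P.W_mono (Nat.zero_le N)

theorem unitFunctionals_subset_Wex (P : Choices) : unitFunctionals ⊆ P.Wex :=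
  P.W_subset_Wex 0

theorem neg_mem_W {N : ℕ} {f : C00} (hf : f ∈ P.W N) : -f ∈ P.W N := by
  cases N with
  | zero =>
    obtain ⟨k, rfl | rfl⟩ := hf
    · exact ⟨k, .inr rfl⟩
    · exact ⟨k, .inl (neg_neg _)⟩
  | succ N =>
    rw [W_succ] at hf ⊢
    exact neg_mem_convQ (fun _ => neg_mem_signedRestrictions) hf

theorem restrict_mem_W {N : ℕ} {f : C00} (hf : f ∈ P.W N) (a b : ℕ+) :
    restrict a b f ∈ P.W N ∨ restrict a b f = 0 := by
  cases N with
  | zero =>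
    obtain ⟨k, rfl | rfl⟩ := hf
    · rw [restrict_e]
      split_ifs
      · exact .inl ⟨k, .inl rfl⟩
      · exact .inr rfl
    · rw [restrict_neg, restrict_e]
      split_ifs
      · exact .inl ⟨k, .inr rfl⟩
      · exact .inr neg_zero
  | succ N =>
    rw [W_succ] at hf ⊢
    exact .inl (restrict_mem_convQ (fun _ h => restrict_mem_signedRestrictions h a b) hf)

theorem zero_mem_Wex (P : Choices) : (0 : C00) ∈ P.Wex := by
  refine P.W_subset_Wex 1 (P.signedRestrictions_V_subset_W 0
    ⟨e 1, P.W_subset_V 0 ⟨1, .inl rfl⟩, 2, 1, .inl ?_⟩)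
  rw [restrict_e, if_neg (by decide)]

theorem neg_mem_Wex {f : C00} (hf : f ∈ P.Wex) : -f ∈ P.Wex := by
  obtain ⟨N, hN⟩ := Set.mem_iUnion.1 hf
  exact P.W_subset_Wex N (neg_mem_W hN)

theorem restrict_mem_Wex {f : C00} (hf : f ∈ P.Wex) (a b : ℕ+) : restrict a b f ∈ P.Wex := by
  obtain ⟨N, hN⟩ := Set.mem_iUnion.1 hf
  rcases restrict_mem_W hN a b with h | h
  · exact P.W_subset_Wex N h
  · rw [h]; exact P.zero_mem_Wex

theorem signedRestrictions_subset {Q : C00 → Prop} {S : Set C00} (hneg : ∀ f, Q f → Q (-f))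
    (hr : ∀ f ∈ S, ∀ a b, Q (restrict a b f)) : ∀ f ∈ signedRestrictions S, Q f := by
  rintro f ⟨g, hg, a, b, rfl | rfl⟩
  · exact hr g hg a b
  · exact hneg _ (hr g hg a b)

/-! ### Special sequences consist of elements of `V_N` -/

theorem hat_mem_V (hP : P.Valid) {N a i : ℕ} (ha : 1 ≤ a) (haN : a ≤ N) {g : C00}
    (hg : g ∈ P.K a i) : hat g ∈ P.V N := by
  obtain ⟨F, hF, hgF⟩ := hP.K_subset a i ha hg
  have hFne : F.Nonempty := Finset.card_pos.1 (by rw [hF]; have := P.four_le_n hP (2 * i); omega)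
  refine .inl ⟨⟨i, ?_⟩, ?_⟩
  · rw [hgF, hat_smul_sum_e]
    have h := isOp_sum_e (a := P.n (2 * i)) (m (2 * i) : ℝ)⁻¹ (P.unitFunctionals_subset_W (N - 1))
      (F := F.map ⟨fun k => 2 * k, fun _ _ h => mul_left_cancel h⟩) (by simpa using hFne)
      (by rw [Finset.card_map]; exact hF.le)
    rwa [Finset.sum_map] at h
  · rintro ⟨i', a', ha', g', hg', hgg⟩
    obtain rfl := hat_injective hgg
    obtain ⟨F', hF', hgF'⟩ := hP.K_subset a' i' (by omega) hg'
    obtain ⟨k, hk⟩ := hFne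
    have h1 : g' k = (m (2 * i) : ℝ)⁻¹ := by
      rw [hgF, Finsupp.smul_apply, sum_e_apply, if_pos hk, smul_eq_mul, mul_one]
    have h2 : g' k = (m (2 * i') : ℝ)⁻¹ := by
      have h0 : g' k ≠ 0 := by rw [h1]; exact inv_ne_zero (m_pos_real _).ne'
      rw [hgF', Finsupp.smul_apply, sum_e_apply] at h0 ⊢
      split_ifs at h0 ⊢ with hk'
      · rw [smul_eq_mul, mul_one]
      · simp at h0
    have h3 : 2 * i = 2 * i' :=
      m_strictMono.injective (Nat.cast_injective (R := ℝ) (inv_injective (h1.symm.trans h2)))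
    obtain rfl : i = i' := by omega
    exact Set.disjoint_left.1 (hP.K_disjoint i a a' ha (by omega) (by omega)) hg hg'

theorem IsSpecial.length_le {V : Set C00} {L : ℕ → ℕ → Set C00} {N j : ℕ} {c : ℕ → ℕ}
    {F : List C00} (h : P.IsSpecial V L N j c F) : F.length ≤ 2 * P.n (2 * j - 1) := by
  obtain ⟨fs, gs, hs, φs, rfl, -, h3, ⟨s1, -⟩, -⟩ := h
  rw [List.length_append, length_interleave, List.length_map]
  omega

theorem IsSpecial.subset_V (hP : P.Valid) {N j : ℕ} {c : ℕ → ℕ}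
    {F : List C00} (h : P.IsSpecial (P.V N) P.L N j c F) : ∀ u ∈ F, u ∈ P.V N := by
  obtain ⟨fs, gs, hs, φs, rfl, -, -, ⟨s1, -, -, ⟨p1, -, -, p4, -⟩, s5, -⟩, h5, -⟩ := h
  have hpair : ∀ k f g, fs[k]? = some f → gs[k]? = some g →
      ∃ i a, c k = 2 * i ∧ 1 ≤ a ∧ a ≤ N ∧ f ∈ P.V N ∩ P.L a i ∧ g = P.ρ a i f := by
    intro k f g hf hg
    refine p4 k f g hf ?_
    rw [List.getElem?_take_of_lt (List.getElem?_eq_some_iff.1 hf).1, hg]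
  intro u hu
  rcases List.mem_append.1 hu with hu | hu
  · rcases mem_interleave hu with hu | hu
    · obtain ⟨k, hk, hku⟩ := List.getElem_of_mem hu
      obtain ⟨i, a, -, -, -, hV, -⟩ := hpair k u (gs[k]'(by omega))
        (List.getElem?_eq_some_iff.2 ⟨hk, hku⟩) (List.getElem?_eq_getElem _)
      exact hV.1
    · obtain ⟨g, hg, rfl⟩ := List.mem_map.1 hu
      obtain ⟨k, hk, hkg⟩ := List.getElem_of_mem hg
      have hg' : gs[k]? = some g := List.getElem?_eq_some_iff.2 ⟨hk, hkg⟩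
      by_cases hkl : k < fs.length
      · obtain ⟨i, a, -, ha, haN, hV, hρ⟩ := hpair k _ g (List.getElem?_eq_getElem hkl) hg'
        exact hat_mem_V hP ha haN (hρ ▸ hP.ρ_mem a i ha hV.2)
      · obtain ⟨i, a, -, ha, haN, hK⟩ := s5 k g (by omega) hg'
        exact hat_mem_V hP ha haN hK
  · exact h5 u hu

/-! ### Induction on `W_ex` -/

theorem exists_sum_of_mem_specialFunctionals (hP : P.Valid) {N j : ℕ} {φ : C00}
    (h : φ ∈ P.specialFunctionals N (P.V N) P.L j) :
    ∃ (d : ℕ) (g : Fin d → C00), 1 ≤ d ∧ d ≤ 2 * P.n (2 * j - 1) ∧ (∀ a, g a ∈ P.V N) ∧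
      (∀ i k, i < k → Before (g i) (g k)) ∧ φ = (m (2 * j - 1) : ℝ)⁻¹ • ∑ a, g a := by
  obtain ⟨c, F, hF, hs, rfl⟩ := h
  refine ⟨F.length, fun a => F[a], List.length_pos_iff.2 hF, hs.length_le,
    fun a => hs.subset_V hP _ (List.getElem_mem _), fun i k hik => ?_, ?_⟩
  · obtain ⟨_, _, _, _, _, hF, _⟩ := hs
    exact List.pairwise_iff_getElem.1 hF _ _ _ _ hik
  · rw [← Fin.sum_univ_getElem]
    rfl

/-- Every weighted functional of weight `m_i` is the result of an `(𝒜_{2 n_i}, m_i⁻¹)`-operation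
on elements of `W_ex`. -/
theorem HasWeight.isOp (hP : P.Valid) {f : C00} {i : ℕ} (h : P.HasWeight f i) :
    IsOp P.Wex (2 * P.n i) (m i : ℝ)⁻¹ f := by
  obtain ⟨-, ⟨-, h⟩ | ⟨j, N, hj, hN, rfl, g, hg, a, b, h⟩⟩ := h
  · exact h.mono subset_rfl (by omega)
  · obtain ⟨N, rfl⟩ := Nat.exists_eq_add_of_le' hN
    obtain ⟨d, g, h1, h2, h3, h4, rfl⟩ := exists_sum_of_mem_specialFunctionals hP hg
    have hmem : ∀ a, g a ∈ P.Wex := fun a => P.W_subset_Wex _ (P.V_subset_W N (h3 a))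
    rcases h with rfl | rfl
    · refine ⟨d, fun k => restrict a b (g k), h1, h2, fun k => restrict_mem_Wex (hmem k) a b,
        fun i k hik => (h4 i k hik).restrict a b, ?_⟩
      rw [restrict_smul, restrict_sum]
    · refine ⟨d, fun k => -restrict a b (g k), h1, h2,
        fun k => neg_mem_Wex (restrict_mem_Wex (hmem k) a b),
        fun i k hik => ((h4 i k hik).restrict a b).neg, ?_⟩
      rw [restrict_smul, restrict_sum, ← smul_neg, Finset.sum_neg_distrib]

theorem Wex_induction (hP : P.Valid) {Q : C00 → Prop} (zero : Q 0)
    (unit : ∀ k, Q (e k)) (neg : ∀ f ∈ P.Wex, Q f → Q (-f))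
    (weighted : ∀ f i d (g : Fin d → C00), P.HasWeight f i → 1 ≤ d → d ≤ 2 * P.n i →
      (∀ a, g a ∈ P.Wex ∧ Q (g a)) → (∀ a b, a < b → Before (g a) (g b)) →
      f = (m i : ℝ)⁻¹ • ∑ a, g a → Q f)
    (conv : ∀ f ∈ convQ {g | g ∈ P.Wex ∧ Q g}, Q f) : ∀ f ∈ P.Wex, Q f := by
  suffices h : ∀ N, ∀ f ∈ P.W N, Q f by
    intro f hf
    obtain ⟨N, hN⟩ := Set.mem_iUnion.1 hf
    exact h N f hN
  intro N
  induction N with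
  | zero =>
    rintro f ⟨k, rfl | rfl⟩
    · exact unit k
    · exact neg _ (P.unitFunctionals_subset_Wex ⟨k, .inl rfl⟩) (unit k)
  | succ N ih =>
    have hWr : ∀ f ∈ P.W N, ∀ a b, restrict a b f ∈ P.Wex ∧ Q (restrict a b f) := by
      intro f hf a b
      rcases restrict_mem_W hf a b with h | h
      · exact ⟨P.W_subset_Wex N h, ih _ h⟩
      · rw [h]; exact ⟨P.zero_mem_Wex, zero⟩
    have hV : ∀ f ∈ P.V (N + 1), ∀ a b, restrict a b f ∈ P.Wex ∧ Q (restrict a b f) := by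
      intro f hf a b
      have hex : restrict a b f ∈ P.Wex :=
        P.W_subset_Wex _ (P.signedRestrictions_V_subset_W N ⟨f, hf, a, b, .inl rfl⟩)
      rcases hf with ⟨⟨j, d, g, h1, h2, h3, h4, rfl⟩, -⟩ | hf
      · refine ⟨hex, weighted _ (2 * j) d (fun k => restrict a b (g k)) ⟨hex, .inl ⟨by simp, d,
          fun k => restrict a b (g k), h1, h2, fun k => (hWr _ (h3 k) a b).1,
          fun i k hik => (h4 i k hik).restrict a b, ?_⟩⟩ h1 (by omega) (fun k => hWr _ (h3 k) a b)
          (fun i k hik => (h4 i k hik).restrict a b) ?_⟩ <;>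
        rw [restrict_smul, restrict_sum]
      · exact hWr f hf a b
    have hS : ∀ j, 1 ≤ j → ∀ f ∈ P.specialFunctionals (N + 1) (P.V (N + 1)) P.L j, ∀ a b,
        restrict a b f ∈ P.Wex ∧ Q (restrict a b f) := by
      intro j hj f hf a b
      have hsr : restrict a b f ∈ signedRestrictions
          (P.specialFunctionals (N + 1) (P.V (N + 1)) P.L j) := ⟨f, hf, a, b, .inl rfl⟩
      have hex : restrict a b f ∈ P.Wex := by
        refine P.W_subset_Wex (N + 1) ?_
        rw [W_succ]
        exact subset_convQ _ ⟨f, .inr ⟨j, hj, hf⟩, a, b, .inl rfl⟩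
      obtain ⟨d, g, h1, h2, h3, h4, rfl⟩ := exists_sum_of_mem_specialFunctionals hP hf
      refine ⟨hex, weighted _ (2 * j - 1) d (fun k => restrict a b (g k))
        ⟨hex, .inr ⟨j, N + 1, hj, by omega, rfl, hsr⟩⟩ h1 h2 (fun k => hV _ (h3 k) a b)
        (fun i k hik => (h4 i k hik).restrict a b) ?_⟩
      rw [restrict_smul, restrict_sum]
    intro f hf
    rw [W_succ] at hf
    refine conv f ?_
    have hsub : signedRestrictions (P.generators (N + 1)) ⊆ {g | g ∈ P.Wex ∧ Q g} := by
      refine signedRestrictions_subset (Q := fun g => g ∈ P.Wex ∧ Q g)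
        (fun g hg => ⟨neg_mem_Wex hg.1, neg g hg.1 hg.2⟩) ?_
      rintro g (hg | ⟨j, hj, hg⟩)
      · exact hV g hg
      · exact hS j hj g hg
    obtain ⟨d, r, g, hr, hr1, hg, rfl⟩ := hf
    exact ⟨d, r, g, hr, hr1, fun i => hsub (hg i), rfl⟩

theorem abs_apply_le_one (hP : P.Valid) (c : ℕ+) : ∀ f ∈ P.Wex, |f c| ≤ 1 := by
  refine Wex_induction hP (by simp) (fun k => ?_) (fun f _ hf => by simpa using hf) ?_ ?_
  · rw [e_apply]; split_ifs <;> simp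
  · rintro f i d g - - - hg hs rfl
    rw [Finsupp.smul_apply, smul_eq_mul, abs_mul, abs_of_pos (inv_pos.2 (m_pos_real i))]
    have h1 : |(∑ a, g a) c| ≤ 1 :=
      abs_sum_apply_le_of_successive (fun a _ b _ => hs a b) zero_le_one c fun a _ => (hg a).2
    have h2 := inv_m_le_half i
    have h3 := inv_pos.2 (m_pos_real i)
    nlinarith [abs_nonneg ((∑ a, g a) c)]
  · intro f hf
    obtain ⟨g, hg, hfg⟩ := exists_abs_pair_le_of_mem_convQ hf (e c)
    rw [pair_e_right, pair_e_right] at hfg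
    exact hfg.trans hg.2

theorem HasWeight.abs_apply_le (hP : P.Valid) {f : C00} {i : ℕ} (h : P.HasWeight f i) (c : ℕ+) :
    |f c| ≤ (m i : ℝ)⁻¹ := by
  obtain ⟨d, g, -, -, hg, hs, rfl⟩ := h.isOp hP
  rw [Finsupp.smul_apply, smul_eq_mul, abs_mul, abs_of_pos (inv_pos.2 (m_pos_real i))]
  exact mul_le_of_le_one_right (inv_pos.2 (m_pos_real i)).le
    (abs_sum_apply_le_of_successive (fun a _ b _ => hs a b) zero_le_one c
      fun a _ => abs_apply_le_one hP c _ (hg a))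

theorem bddAbove_pair (hP : P.Valid) (x : C00) :
    BddAbove ((fun f => pair f x) '' P.Wex) := by
  refine ⟨∑ c ∈ x.support, |x c|, ?_⟩
  rintro _ ⟨f, hf, rfl⟩
  change pair f x ≤ _
  rw [pair_comm]
  refine Finset.sum_le_sum fun c _ => (le_abs_self _).trans ?_
  rw [abs_mul]
  exact mul_le_of_le_one_right (abs_nonneg _) (abs_apply_le_one hP c f hf)

theorem abs_pair_le_normBy (hP : P.Valid) {f : C00} (hf : f ∈ P.Wex) (x : C00) :
    |pair f x| ≤ normBy P.Wex x := by
  refine abs_le'.2 ⟨le_csSup (bddAbove_pair hP x) ⟨f, hf, rfl⟩, ?_⟩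
  rw [← pair_neg_left]
  exact le_csSup (bddAbove_pair hP x) ⟨-f, neg_mem_Wex hf, rfl⟩

theorem abs_apply_le_normBy (hP : P.Valid) (x : C00) (c : ℕ+) : |x c| ≤ normBy P.Wex x := by
  rw [← pair_e_left]
  exact abs_pair_le_normBy hP (P.unitFunctionals_subset_Wex ⟨c, .inl rfl⟩) x

end Choices
end HIExt

namespace HIExt

/-! ### Splitting a block sequence along successive functionals -/

/-- Given a block sequence `(z_k)_{k ∈ E}` and successive functionals `g_1 < ⋯ < g_d`, at most `d`
indices `k ∈ T` are met by two of the functionals, and the other indices that matter are grouped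
into successive intervals `A_a` of `E` such that only `g_a` acts on `(z_k)_{k ∈ A_a}`. -/
theorem exists_splitting {ι : Type*} [LinearOrder ι] (z : ι → C00) (E : Finset ι)
    (hz : ∀ k ∈ E, ∀ l ∈ E, k < l → Before (z k) (z l)) {d : ℕ} (g : Fin d → C00)
    (hg : ∀ a b, a < b → Before (g a) (g b)) :
    ∃ (T : Finset ι) (A : Fin d → Finset ι), T ⊆ E ∧ T.card ≤ d ∧ (∀ a, A a ⊆ E) ∧
      (∀ a, ∀ t ∈ T, (∀ k ∈ A a, t < k) ∨ ∀ k ∈ A a, k < t) ∧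
      (∀ a b, a < b → ∀ k ∈ A a, ∀ l ∈ A b, k < l) ∧
      (∀ a, ∀ k ∈ A a, ∀ l ∈ A a, ∀ i ∈ E, k ≤ i → i ≤ l → i ∈ A a) ∧
      ∀ μ : ι → ℝ, pair (∑ a, g a) (∑ k ∈ E, μ k • z k) =
        ∑ a, pair (g a) (∑ k ∈ A a, μ k • z k) + ∑ k ∈ T, μ k * pair (∑ a, g a) (z k) := by
  classical
  let meets : Fin d → ι → Prop := fun a k => ∃ c ∈ (g a).support, c ∈ (z k).support
  have horder : ∀ a b, a < b → ∀ k ∈ E, ∀ l ∈ E, meets a k → meets b l → k ≤ l := by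
    rintro a b hab k hk l hl ⟨c, hc, hc'⟩ ⟨c₂, hc₂, hc₂'⟩
    by_contra! hlt
    exact lt_asymm (hg a b hab c hc c₂ hc₂) (hz l hl k hk hlt c₂ hc₂' c hc')
  let T : Finset ι := {k ∈ E | ∃ a b, a < b ∧ meets a k ∧ meets b k}
  let A : Fin d → Finset ι := fun a =>
    {k ∈ E | ∃ k₁ ∈ E \ T, ∃ k₂ ∈ E \ T, meets a k₁ ∧ meets a k₂ ∧ k₁ ≤ k ∧ k ≤ k₂}
  have hTmem : ∀ {k}, k ∈ T ↔ k ∈ E ∧ ∃ a b, a < b ∧ meets a k ∧ meets b k := by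
    intro k; exact Finset.mem_filter
  have hAmem : ∀ {a k}, k ∈ A a ↔ k ∈ E ∧ ∃ k₁ ∈ E \ T, ∃ k₂ ∈ E \ T,
      meets a k₁ ∧ meets a k₂ ∧ k₁ ≤ k ∧ k ≤ k₂ := by
    intro a k; exact Finset.mem_filter
  have huniq : ∀ {k a b}, k ∈ E \ T → meets a k → meets b k → a = b := by
    intro k a b hk ha hb
    obtain ⟨hkE, hkT⟩ := Finset.mem_sdiff.1 hk
    rcases lt_trichotomy a b with h | h | h
    · exact absurd (hTmem.2 ⟨hkE, a, b, h, ha, hb⟩) hkT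
    · exact h
    · exact absurd (hTmem.2 ⟨hkE, b, a, h, hb, ha⟩) hkT
  have hAT : ∀ a k, k ∈ A a → k ∉ T ∧ ∀ b, meets b k → b = a := by
    intro a k hk
    obtain ⟨hkE, k₁, h₁, k₂, h₂, hm₁, hm₂, hk₁, hk₂⟩ := hAmem.1 hk
    have key : ∀ b, meets b k → b = a := by
      intro b hb
      rcases lt_trichotomy b a with h | h | h
      · have := horder b a h k hkE k₁ (Finset.mem_sdiff.1 h₁).1 hb hm₁
        obtain rfl : k = k₁ := le_antisymm this hk₁
        exact huniq h₁ hb hm₁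
      · exact h
      · have := horder a b h k₂ (Finset.mem_sdiff.1 h₂).1 k hkE hm₂ hb
        obtain rfl : k = k₂ := le_antisymm hk₂ this
        exact huniq h₂ hb hm₂
    refine ⟨fun hT => ?_, key⟩
    obtain ⟨-, b, b', hbb, hb, hb'⟩ := hTmem.1 hT
    exact hbb.ne ((key b hb).trans (key b' hb').symm)
  have hAconn : ∀ a, ∀ k ∈ A a, ∀ l ∈ A a, ∀ i ∈ E, k ≤ i → i ≤ l → i ∈ A a := by
    intro a k hk l hl i hi hki hil
    obtain ⟨-, k₁, h₁, -, -, hm₁, -, hk₁, -⟩ := hAmem.1 hk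
    obtain ⟨-, -, -, l₂, h₂, -, hm₂, -, hl₂⟩ := hAmem.1 hl
    exact hAmem.2 ⟨hi, k₁, h₁, l₂, h₂, hm₁, hm₂, hk₁.trans hki, hil.trans hl₂⟩
  have hAlt : ∀ a b, a < b → ∀ k ∈ A a, ∀ l ∈ A b, k < l := by
    intro a b hab k hk l hl
    obtain ⟨-, -, -, k₂, h₂, -, hm₂, -, hk₂⟩ := hAmem.1 hk
    obtain ⟨-, l₁, h₁, -, -, hm₁, -, hl₁, -⟩ := hAmem.1 hl
    have hle := horder a b hab k₂ (Finset.mem_sdiff.1 h₂).1 l₁ (Finset.mem_sdiff.1 h₁).1 hm₂ hm₁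
    have hne : k₂ ≠ l₁ := by
      rintro rfl
      exact hab.ne (huniq h₂ hm₂ hm₁)
    exact (hk₂.trans_lt (lt_of_le_of_ne hle hne)).trans_le hl₁
  refine ⟨T, A, Finset.filter_subset _ _, ?_, fun a => Finset.filter_subset _ _, ?_, hAlt, hAconn,
    fun μ => ?_⟩
  · have hex : ∀ k : T, ∃ a b : Fin d, a < b ∧ meets a k ∧ meets b k := fun k => (hTmem.1 k.2).2
    choose p b hb hm hm' using hex
    have hinj : Function.Injective p := by
      intro k l hkl
      have hkE := (hTmem.1 k.2).1
      have hlE := (hTmem.1 l.2).1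
      exact Subtype.ext (le_antisymm
        (horder _ _ (hkl ▸ hb l) k hkE l hlE (hm k) (hm' l))
        (horder _ _ (hkl ▸ hb k) l hlE k hkE (hm l) (hm' k)))
    simpa using Fintype.card_le_of_injective p hinj
  · intro a t ht
    by_contra! h
    obtain ⟨⟨k, hk, hkt⟩, l, hl, htl⟩ := h
    exact (hAT a t (hAconn a k hk l hl t (hTmem.1 ht).1 hkt htl)).1 ht
  · have hsplit : ∀ a, pair (g a) (∑ k ∈ E, μ k • z k) =
        pair (g a) (∑ k ∈ A a, μ k • z k) + pair (g a) (∑ k ∈ T, μ k • z k) := by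
      intro a
      have hdisj : Disjoint (A a) T := Finset.disjoint_left.2 fun k hk => (hAT a k hk).1
      rw [pair_sum_right, pair_sum_right, pair_sum_right, ← Finset.sum_union hdisj]
      symm
      refine Finset.sum_subset (Finset.union_subset (Finset.filter_subset _ _)
        (Finset.filter_subset _ _)) fun k hkE hk => ?_
      rw [Finset.mem_union, not_or] at hk
      rw [pair_smul_right, pair_eq_zero_of_disjoint, mul_zero]
      intro c hc hc'
      have hkT : k ∈ E \ T := Finset.mem_sdiff.2 ⟨hkE, hk.2⟩
      exact hk.1 (hAmem.2 ⟨hkE, k, hkT, k, hkT, ⟨c, hc, hc'⟩, ⟨c, hc, hc'⟩, le_rfl, le_rfl⟩)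
    rw [pair_sum_left, Finset.sum_congr rfl fun a _ => hsplit a, Finset.sum_add_distrib,
      ← pair_sum_left, pair_sum_right _ (∑ a, g a)]
    simp only [pair_smul_right]

/-- The intervals of a splitting are disjoint. -/
theorem sum_sum_le_of_ordered {ι : Type*} [LinearOrder ι] {E : Finset ι} {d : ℕ}
    {A : Fin d → Finset ι} (hA : ∀ a, A a ⊆ E)
    (hlt : ∀ a b, a < b → ∀ k ∈ A a, ∀ l ∈ A b, k < l) {T : Finset ι} (hT : T ⊆ E)
    (hAT : ∀ a, ∀ t ∈ T, (∀ k ∈ A a, t < k) ∨ ∀ k ∈ A a, k < t) {w : ι → ℝ}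
    (hw : ∀ k ∈ E, 0 ≤ w k) : ∑ a, ∑ k ∈ A a, w k + ∑ k ∈ T, w k ≤ ∑ k ∈ E, w k := by
  classical
  have hd : Set.PairwiseDisjoint (↑(Finset.univ : Finset (Fin d))) A := by
    intro a _ b _ hab
    refine Finset.disjoint_left.2 fun k hk hk' => ?_
    rcases lt_or_gt_of_ne hab with h | h
    · exact lt_irrefl _ (hlt a b h k hk k hk')
    · exact lt_irrefl _ (hlt b a h k hk' k hk)
  rw [← Finset.sum_biUnion hd, ← Finset.sum_union]
  · refine Finset.sum_le_sum_of_subset_of_nonneg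
      (Finset.union_subset (Finset.biUnion_subset.2 fun a _ => hA a) hT) fun k hk _ => hw k hk
  · refine Finset.disjoint_left.2 fun k hk hk' => ?_
    obtain ⟨a, -, ha⟩ := Finset.mem_biUnion.1 hk
    rcases hAT a k hk' with h | h <;> exact lt_irrefl _ (h k ha)

namespace Choices

variable {P : Choices}

/-! ### Averages of spread block sequences -/

/-- The properties of the blocks of an exact pair, and of unit vectors, that control the action of
`W_ex` on `(m_q / n_q) ∑ y_k`. -/
structure IsSpread (P : Choices) (C : ℝ) (q : ℕ) (y : Fin (P.n q) → C00) : Prop where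
  block : ∀ k l, k < l → Before (y k) (y l)
  norm_le : ∀ k, ∀ φ ∈ P.Wex, |pair φ (y k)| ≤ C
  heavy : ∀ φ i, q ≤ i → P.HasWeight φ i → ∃ k₀, ∀ k, k ≠ k₀ →
    |pair φ (y k)| ≤ C * if i = q then (m q : ℝ)⁻¹ else (m q : ℝ)⁻¹ ^ 2

variable {C : ℝ} {q : ℕ} {y : Fin (P.n q) → C00}

theorem IsSpread.nonneg (hP : P.Valid) (hy : P.IsSpread C q y) : 0 ≤ C :=
  (abs_nonneg _).trans
    (hy.norm_le ⟨0, by have := P.four_le_n hP q; omega⟩ 0 P.zero_mem_Wex)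

theorem IsSpread.abs_pair_le_of_heavy (hP : P.Valid) (hy : P.IsSpread C q y) {φ : C00} {i : ℕ}
    (hqi : q ≤ i) (hφ : P.HasWeight φ i) (E : Finset (Fin (P.n q))) :
    |pair φ (∑ k ∈ E, y k)| ≤
      C * (E.card * (if i = q then (m q : ℝ)⁻¹ else (m q : ℝ)⁻¹ ^ 2) + 1) := by
  classical
  have hC := hy.nonneg hP
  obtain ⟨k₀, h₀⟩ := hy.heavy φ i hqi hφ
  set B : ℝ := if i = q then (m q : ℝ)⁻¹ else (m q : ℝ)⁻¹ ^ 2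
  have hB : 0 ≤ B := by
    have := m_pos_real q
    simp only [B]; split_ifs <;> positivity
  rw [pair_sum_right]
  calc |∑ k ∈ E, pair φ (y k)| ≤ ∑ k ∈ E, |pair φ (y k)| := Finset.abs_sum_le_sum_abs _ _
    _ ≤ ∑ k ∈ E, (C * B + if k = k₀ then C else 0) := by
        refine Finset.sum_le_sum fun k _ => ?_
        split_ifs with hk
        · have := hy.norm_le k φ hφ.1
          have := mul_nonneg hC hB
          linarith
        · rw [add_zero]; exact h₀ k hk
    _ ≤ C * (E.card * B + 1) := by
        rw [Finset.sum_add_distrib, Finset.sum_const, nsmul_eq_mul, Finset.sum_ite_eq']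
        split_ifs <;> nlinarith

theorem IsSpread.abs_pair_le_of_light (hP : P.Valid) (hy : P.IsSpread C q y) {φ : C00} {i p : ℕ}
    (hip : i ≤ p) (hφ : P.HasWeight φ i) {D M : ℝ} (hD : 0 < D) (hM : 0 ≤ M)
    (h : ∀ ψ ∈ P.Wex, ∀ E : Finset (Fin (P.n q)),
      |pair ψ (∑ k ∈ E, y k)| ≤ C * (E.card / D + M)) (E : Finset (Fin (P.n q))) :
    |pair φ (∑ k ∈ E, y k)| ≤ C * ((m i : ℝ)⁻¹ * (E.card / D) + P.n p * M + 2 * P.n p) := by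
  have hC := hy.nonneg hP
  obtain ⟨d, g, -, hd, hg, hs, hφg⟩ := hφ.isOp hP
  obtain ⟨T, A, hT, hTd, hA, hAT, hAA, -, hsum⟩ :=
    exists_splitting y E (fun k _ l _ => hy.block k l) g hs
  have hdp : (d : ℝ) ≤ 2 * P.n p := by
    have := n_mono hP hip
    exact_mod_cast hd.trans (by omega)
  have hsum := hsum fun _ => 1
  simp only [one_smul, one_mul] at hsum
  have hm := inv_pos.2 (m_pos_real i)
  have hm2 := inv_m_le_half i
  have hcard : (∑ a, ((A a).card : ℝ)) ≤ E.card := by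
    have h1 := sum_sum_le_of_ordered hA hAA hT hAT (w := fun _ => (1 : ℝ)) (by simp)
    simp only [Finset.sum_const, nsmul_eq_mul, mul_one] at h1
    have : (0 : ℝ) ≤ T.card := Nat.cast_nonneg _
    linarith
  have h1 : |∑ a, pair (g a) (∑ k ∈ A a, y k)| ≤ C * (E.card / D + d * M) := by
    calc |∑ a, pair (g a) (∑ k ∈ A a, y k)| ≤ ∑ a, |pair (g a) (∑ k ∈ A a, y k)| :=
          Finset.abs_sum_le_sum_abs _ _
      _ ≤ ∑ a, C * ((A a).card / D + M) := Finset.sum_le_sum fun a _ => h _ (hg a) _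
      _ = C * ((∑ a, ((A a).card : ℝ)) / D + d * M) := by
          rw [← Finset.mul_sum, Finset.sum_add_distrib, Finset.sum_div]; simp
      _ ≤ _ := by gcongr
  have h2 : |∑ k ∈ T, pair φ (y k)| ≤ C * d := by
    calc |∑ k ∈ T, pair φ (y k)| ≤ ∑ k ∈ T, |pair φ (y k)| := Finset.abs_sum_le_sum_abs _ _
      _ ≤ ∑ _k ∈ T, C := Finset.sum_le_sum fun k _ => hy.norm_le k φ hφ.1
      _ = C * T.card := by rw [Finset.sum_const, nsmul_eq_mul, mul_comm]
      _ ≤ C * d := by gcongr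
  have h3 : pair φ (∑ k ∈ E, y k) =
      (m i : ℝ)⁻¹ * ∑ a, pair (g a) (∑ k ∈ A a, y k) + ∑ k ∈ T, pair φ (y k) := by
    simp only [hφg, pair_smul_left]
    rw [hsum, mul_add, Finset.mul_sum T]
  rw [h3]
  refine (abs_add_le _ _).trans ?_
  rw [abs_mul, abs_of_pos hm]
  calc (m i : ℝ)⁻¹ * |∑ a, pair (g a) (∑ k ∈ A a, y k)| + |∑ k ∈ T, pair φ (y k)|
      ≤ (m i : ℝ)⁻¹ * (C * (E.card / D + d * M)) + C * d := by gcongr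
    _ = C * ((m i : ℝ)⁻¹ * (E.card / D) + (m i : ℝ)⁻¹ * (d * M) + d) := by ring
    _ ≤ C * ((m i : ℝ)⁻¹ * (E.card / D) + 1 / 2 * (2 * P.n p * M) + 2 * P.n p) := by gcongr
    _ = _ := by ring

theorem IsSpread.abs_pair_le (hP : P.Valid) {p : ℕ} {y : Fin (P.n (p + 1)) → C00}
    (hy : P.IsSpread C (p + 1) y) (r : ℕ) (hr : 2 ^ r ≤ m (p + 1)) :
    ∀ φ ∈ P.Wex, ∀ E : Finset (Fin (P.n (p + 1))),
      |pair φ (∑ k ∈ E, y k)| ≤ C * (E.card / 2 ^ r + (12 * P.n p) ^ r) := by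
  have hC := hy.nonneg hP
  have hn : (4 : ℝ) ≤ P.n p := by exact_mod_cast P.four_le_n hP p
  induction r with
  | zero =>
    intro φ hφ E
    rw [pair_sum_right]
    calc |∑ k ∈ E, pair φ (y k)| ≤ ∑ k ∈ E, |pair φ (y k)| := Finset.abs_sum_le_sum_abs _ _
      _ ≤ ∑ _k ∈ E, C := Finset.sum_le_sum fun k _ => hy.norm_le k φ hφ
      _ ≤ _ := by
        rw [Finset.sum_const, nsmul_eq_mul]
        simp only [pow_zero]
        linarith
  | succ r ih =>
    have ih := ih (le_trans (Nat.pow_le_pow_right (by norm_num) (Nat.le_succ r)) hr)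
    have hM : (1 : ℝ) ≤ (12 * P.n p) ^ r := one_le_pow₀ (by linarith)
    have hM' : (1 : ℝ) ≤ (12 * P.n p) ^ (r + 1) := one_le_pow₀ (by linarith)
    refine Wex_induction hP ?_ ?_ ?_ ?_ ?_
    · intro E
      rw [pair_zero_left, abs_zero]
      positivity
    · intro c E
      rw [pair_e_left]
      refine (abs_sum_apply_le_of_successive (fun a _ b _ => hy.block a b) hC c
        fun k _ => ?_).trans ?_
      · rw [← pair_e_left]
        exact hy.norm_le k _ (P.unitFunctionals_subset_Wex ⟨c, .inl rfl⟩)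
      · refine le_mul_of_one_le_right hC (hM'.trans (le_add_of_nonneg_left (by positivity)))
    · intro f _ hf E
      rw [pair_neg_left, abs_neg]
      exact hf E
    · intro f i d g hf _ _ _ _ _ E
      by_cases hi : i ≤ p
      · refine (hy.abs_pair_le_of_light hP hi hf (D := 2 ^ r) (M := (12 * P.n p) ^ r)
          (by positivity) (by positivity) ih E).trans ?_
        refine mul_le_mul_of_nonneg_left ?_ hC
        have h1 : (m i : ℝ)⁻¹ * (E.card / 2 ^ r) ≤ 1 / 2 * (E.card / 2 ^ r) := by
          have := inv_m_le_half i
          gcongr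
        have h2 : (1 : ℝ) / 2 * (E.card / 2 ^ r) = E.card / 2 ^ (r + 1) := by
          rw [pow_succ]; field_simp
        have h3 : (P.n p : ℝ) * (12 * P.n p) ^ r + 2 * P.n p ≤ (12 * P.n p) ^ (r + 1) := by
          rw [pow_succ]; nlinarith
        linarith
      · refine (hy.abs_pair_le_of_heavy hP (by omega) hf E).trans ?_
        have h1 : (m (p + 1) : ℝ)⁻¹ ≤ (2 ^ (r + 1))⁻¹ :=
          inv_anti₀ (by positivity) (by exact_mod_cast hr)
        have h2 : (m (p + 1) : ℝ)⁻¹ ^ 2 ≤ (m (p + 1) : ℝ)⁻¹ := by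
          have := inv_m_le_half (p + 1)
          have := inv_pos.2 (m_pos_real (p + 1))
          nlinarith
        have h3 : (if i = p + 1 then (m (p + 1) : ℝ)⁻¹ else (m (p + 1) : ℝ)⁻¹ ^ 2) ≤
            (2 ^ (r + 1))⁻¹ := by split_ifs <;> linarith
        rw [div_eq_mul_inv]
        gcongr
    · intro f hf E
      obtain ⟨g, hg, hfg⟩ := exists_abs_pair_le_of_mem_convQ hf (∑ k ∈ E, y k)
      exact hfg.trans (hg.2 E)

theorem m_sq_mul_le_n (hP : P.Valid) (p : ℕ) :
    (m (p + 1) : ℝ) ^ 2 * (P.n p * (12 * P.n p) ^ 5 ^ (p + 1) + 2 * P.n p) ≤ P.n (p + 1) := by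
  have hn : (4 : ℝ) ≤ P.n p := by exact_mod_cast P.four_le_n hP p
  have h : ((12 * P.n p : ℝ)) ^ (3 * 5 ^ (p + 1)) ≤ P.n (p + 1) := by
    exact_mod_cast pow_le_n_succ hP p
  refine le_trans ?_ h
  have hr : 1 ≤ 5 ^ (p + 1) := Nat.one_le_pow _ _ (by norm_num)
  have hM : (1 : ℝ) ≤ (12 * P.n p) ^ 5 ^ (p + 1) := one_le_pow₀ (by linarith)
  have h1 : (m (p + 1) : ℝ) ^ 2 ≤ (12 * P.n p) ^ 5 ^ (p + 1) := by
    rw [m_eq, Nat.cast_pow, ← pow_mul, mul_comm _ 2, pow_mul]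
    gcongr
    norm_num
    linarith
  have h2 : (P.n p : ℝ) * (12 * P.n p) ^ 5 ^ (p + 1) + 2 * P.n p ≤
      (12 * P.n p) ^ 5 ^ (p + 1) * (12 * P.n p) ^ 5 ^ (p + 1) := by
    have : (12 * P.n p : ℝ) ≤ (12 * P.n p) ^ 5 ^ (p + 1) :=
      le_self_pow₀ (by linarith) (by omega)
    nlinarith
  calc _ ≤ (12 * P.n p : ℝ) ^ 5 ^ (p + 1) *
        ((12 * P.n p) ^ 5 ^ (p + 1) * (12 * P.n p) ^ 5 ^ (p + 1)) := by gcongr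
    _ = _ := by ring

theorem m_div_n_le (hP : P.Valid) (p : ℕ) :
    (m (p + 1) : ℝ) / P.n (p + 1) ≤ (m (p + 1) : ℝ)⁻¹ := by
  have hn : (4 : ℝ) ≤ P.n (p + 1) := by exact_mod_cast P.four_le_n hP (p + 1)
  have hn' : (4 : ℝ) ≤ P.n p := by exact_mod_cast P.four_le_n hP p
  have hm := m_pos_real (p + 1)
  have h := m_sq_mul_le_n hP p
  have h1 : (1 : ℝ) ≤ P.n p * (12 * P.n p) ^ 5 ^ (p + 1) + 2 * P.n p := by
    have : (0 : ℝ) ≤ P.n p * (12 * P.n p) ^ 5 ^ (p + 1) := by positivity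
    linarith
  rw [div_le_iff₀ (by linarith), ← div_eq_inv_mul, le_div_iff₀ hm]
  nlinarith [sq_nonneg (m (p + 1) : ℝ)]

/-- The action of `W_ex` on `x` is essentially the one on `(m_q / n_q) ∑ y_k` for a spread
sequence `y`, up to the error `C ε`. -/
structure IsAverage (P : Choices) (C : ℝ) (q : ℕ) (ε : ℝ) (x : C00) : Prop where
  apply_le : ∀ c, |x c| ≤ C * ε
  light : ∀ φ i, i < q → P.HasWeight φ i → |pair φ x| ≤ C * ((m i : ℝ)⁻¹ + ε)
  same : ∀ φ, P.HasWeight φ q → |pair φ x| ≤ C * (1 + ε)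
  heavy : ∀ φ i, q < i → P.HasWeight φ i → |pair φ x| ≤ C * ε

theorem IsSpread.isAverage (hP : P.Valid) {p : ℕ} {y : Fin (P.n (p + 1)) → C00}
    (hy : P.IsSpread C (p + 1) y) :
    P.IsAverage C (p + 1) (2 * (m (p + 1) : ℝ)⁻¹)
      (((m (p + 1) : ℝ) / P.n (p + 1)) • ∑ k, y k) := by
  have hC := hy.nonneg hP
  have hm := m_pos_real (p + 1)
  have hn : (0 : ℝ) < P.n (p + 1) := by
    have := P.four_le_n hP (p + 1)
    exact_mod_cast (by omega : 0 < P.n (p + 1))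
  have hmn := m_div_n_le hP p
  have hmn0 : 0 < (m (p + 1) : ℝ) / P.n (p + 1) := by positivity
  have hcancel : (m (p + 1) : ℝ) / P.n (p + 1) * (P.n (p + 1) * (m (p + 1) : ℝ)⁻¹) = 1 := by
    field_simp
  refine ⟨fun c => ?_, fun φ i hi hφ => ?_, fun φ hφ => ?_, fun φ i hi hφ => ?_⟩
  · rw [Finsupp.smul_apply, smul_eq_mul, abs_mul, abs_of_pos hmn0]
    have h1 : |(∑ k, y k) c| ≤ C :=
      abs_sum_apply_le_of_successive (fun a _ b _ => hy.block a b) hC c fun k _ => by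
        rw [← pair_e_left]
        exact hy.norm_le k _ (P.unitFunctionals_subset_Wex ⟨c, .inl rfl⟩)
    calc _ ≤ (m (p + 1) : ℝ)⁻¹ * C := by gcongr
      _ ≤ _ := by have : 0 ≤ (m (p + 1) : ℝ)⁻¹ * C := by positivity
                  linarith
  · rw [pair_smul_right, abs_mul, abs_of_pos hmn0]
    have hr : (2 : ℝ) ^ 5 ^ (p + 1) = m (p + 1) := by rw [m_eq]; norm_num
    have h := hy.abs_pair_le_of_light hP (Nat.lt_succ_iff.1 hi) hφ (D := m (p + 1))
      (M := (12 * P.n p) ^ 5 ^ (p + 1)) hm (by positivity) (by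
        have := hy.abs_pair_le hP (5 ^ (p + 1)) (m_eq _).ge
        rwa [hr] at this) Finset.univ
    rw [Finset.card_univ, Fintype.card_fin] at h
    have hbig : (m (p + 1) : ℝ) / P.n (p + 1) *
        (P.n p * (12 * P.n p) ^ 5 ^ (p + 1) + 2 * P.n p) ≤ (m (p + 1) : ℝ)⁻¹ := by
      have := m_sq_mul_le_n hP p
      rw [div_mul_eq_mul_div, div_le_iff₀ hn, ← div_eq_inv_mul, le_div_iff₀ hm]
      linarith
    calc _ ≤ (m (p + 1) : ℝ) / P.n (p + 1) * (C * ((m i : ℝ)⁻¹ * (P.n (p + 1) / m (p + 1)) +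
          P.n p * (12 * P.n p) ^ 5 ^ (p + 1) + 2 * P.n p)) := by gcongr
      _ = C * ((m i : ℝ)⁻¹ * ((m (p + 1) : ℝ) / P.n (p + 1) *
            (P.n (p + 1) * (m (p + 1) : ℝ)⁻¹)) + (m (p + 1) : ℝ) / P.n (p + 1) *
            (P.n p * (12 * P.n p) ^ 5 ^ (p + 1) + 2 * P.n p)) := by ring
      _ ≤ C * ((m i : ℝ)⁻¹ + 2 * (m (p + 1) : ℝ)⁻¹) := by
          rw [hcancel, mul_one]
          have : 0 < (m (p + 1) : ℝ)⁻¹ := by positivity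
          refine mul_le_mul_of_nonneg_left ?_ hC
          linarith
  · rw [pair_smul_right, abs_mul, abs_of_pos hmn0]
    have h := hy.abs_pair_le_of_heavy hP le_rfl hφ Finset.univ
    rw [if_pos rfl, Finset.card_univ, Fintype.card_fin] at h
    calc _ ≤ (m (p + 1) : ℝ) / P.n (p + 1) * (C * (P.n (p + 1) * (m (p + 1) : ℝ)⁻¹ + 1)) := by
          gcongr
      _ = C * ((m (p + 1) : ℝ) / P.n (p + 1) * (P.n (p + 1) * (m (p + 1) : ℝ)⁻¹) +
            (m (p + 1) : ℝ) / P.n (p + 1)) := by ring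
      _ ≤ _ := by
          rw [hcancel]
          have : 0 < (m (p + 1) : ℝ)⁻¹ := by positivity
          gcongr
          linarith
  · rw [pair_smul_right, abs_mul, abs_of_pos hmn0]
    have h := hy.abs_pair_le_of_heavy hP hi.le hφ Finset.univ
    rw [if_neg hi.ne', Finset.card_univ, Fintype.card_fin] at h
    calc _ ≤ (m (p + 1) : ℝ) / P.n (p + 1) *
            (C * (P.n (p + 1) * (m (p + 1) : ℝ)⁻¹ ^ 2 + 1)) := by gcongr
      _ = C * ((m (p + 1) : ℝ) / P.n (p + 1) * (P.n (p + 1) * (m (p + 1) : ℝ)⁻¹) *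
            (m (p + 1) : ℝ)⁻¹ + (m (p + 1) : ℝ) / P.n (p + 1)) := by ring
      _ ≤ _ := by
          rw [hcancel]
          gcongr
          linarith

theorem inv_m_le_of_le {i q : ℕ} (h : q ≤ i) :
    (m i : ℝ)⁻¹ ≤ if i = q then (m q : ℝ)⁻¹ else (m q : ℝ)⁻¹ ^ 2 := by
  have hm := m_pos_real q
  split_ifs with hi
  · rw [hi]
  · refine (inv_m_anti (show q + 1 ≤ i by omega)).trans ?_
    rw [inv_pow]
    refine inv_anti₀ (by positivity) ?_
    rw [m, Nat.cast_pow]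
    exact pow_le_pow_right₀ (by exact_mod_cast m_pos q) (by norm_num)

theorem isSpread_e (hP : P.Valid) (hC : 1 ≤ C) {k : Fin (P.n q) → ℕ+} (hk : StrictMono k) :
    P.IsSpread C q fun i => e (k i) := by
  refine ⟨fun i l hil => before_e (hk hil), fun i φ hφ => ?_, fun φ i hqi hφ =>
    ⟨⟨0, by have := P.four_le_n hP q; omega⟩, fun l _ => ?_⟩⟩
  · rw [pair_e_right]
    exact (abs_apply_le_one hP _ φ hφ).trans hC
  · rw [pair_e_right]
    refine (hφ.abs_apply_le hP _).trans ?_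
    have hm := m_pos_real q
    refine (inv_m_le_of_le hqi).trans (le_mul_of_one_le_left (by split_ifs <;> positivity) hC)

theorem IsRIS.isSpread (hP : P.Valid) (hC : 0 ≤ C) (hy : P.IsRIS C ((m q : ℝ)⁻¹ ^ 2) y) :
    P.IsSpread C q y := by
  obtain ⟨-, hb, t, ht, -, hn, hcard, hlow⟩ := hy
  refine ⟨hb, fun k φ hφ => (abs_pair_le_normBy hP hφ _).trans (hn k), fun φ i hqi hφ => ?_⟩
  have hm := m_pos_real q
  have hpos : 0 < P.n q := by have := P.four_le_n hP q; omega
  have hi := inv_m_le_of_le hqi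
  have hq2 : (m q : ℝ)⁻¹ ^ 2 ≤ if i = q then (m q : ℝ)⁻¹ else (m q : ℝ)⁻¹ ^ 2 := by
    split_ifs
    · have := inv_m_le_half q
      have := inv_pos.2 hm
      nlinarith
    · exact le_rfl
  have hex : ∃ k₀ : Fin (P.n q), ∀ k, t k ≤ i → k ≠ k₀ → k < k₀ ∧ t k₀ ≤ i := by
    by_cases h : ∃ k, t k ≤ i
    · classical
      have hne : (Finset.univ.filter fun k => t k ≤ i).Nonempty := by
        obtain ⟨k, hk⟩ := h
        exact ⟨k, by simpa using hk⟩
      refine ⟨Finset.max' _ hne, fun k hk hne' => ?_⟩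
      have h1 := Finset.le_max' (Finset.univ.filter fun k => t k ≤ i) k (by simpa using hk)
      have h2 := Finset.max'_mem _ hne
      exact ⟨lt_of_le_of_ne h1 hne', (Finset.mem_filter.1 h2).2⟩
    · exact ⟨⟨0, hpos⟩, fun k hk => absurd ⟨k, hk⟩ h⟩
  obtain ⟨k₀, hk₀⟩ := hex
  refine ⟨k₀, fun k hk => ?_⟩
  by_cases hki : t k ≤ i
  · obtain ⟨hlt, hk₀i⟩ := hk₀ k hki hk
    let l : Fin (P.n q) := ⟨k + 1, by omega⟩
    have hl : t l ≤ i := (ht.monotone (show l ≤ k₀ from Nat.succ_le_of_lt hlt)).trans hk₀i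
    have h1 := abs_pair_le_card (hφ.abs_apply_le hP)
      (fun c => (abs_apply_le_normBy hP (y k) c).trans (hn k))
    calc |pair φ (y k)| ≤ (y k).support.card * ((m i : ℝ)⁻¹ * C) := h1
      _ = C * ((m i : ℝ)⁻¹ * (y k).support.card) := by ring
      _ ≤ C * ((m (t l) : ℝ)⁻¹ * (y k).support.card) := by
          have := inv_m_anti hl
          gcongr
      _ ≤ C * (m q : ℝ)⁻¹ ^ 2 := mul_le_mul_of_nonneg_left (hcard k l rfl) hC
      _ ≤ _ := mul_le_mul_of_nonneg_left hq2 hC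
  · refine (hlow k φ i (by omega) hφ).trans ?_
    rw [div_eq_mul_inv]
    exact mul_le_mul_of_nonneg_left hi hC

end Choices
end HIExt

namespace HIExt

theorem sum_apply_eq_of_successive {ι : Type*} [LinearOrder ι] {s : Finset ι} {g : ι → C00}
    (hg : ∀ i ∈ s, ∀ k ∈ s, i < k → Before (g i) (g k)) {c : ℕ+} {i : ι} (hi : i ∈ s)
    (hc : g i c ≠ 0) : (∑ i ∈ s, g i) c = g i c := by
  rw [Finsupp.finsetSum_apply, Finset.sum_eq_single_of_mem i hi]
  intro k hk hki
  by_contra hkc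
  replace hkc := Finsupp.mem_support_iff.2 hkc
  replace hc := Finsupp.mem_support_iff.2 hc
  rcases lt_or_gt_of_ne hki with hlt | hlt
  · exact lt_irrefl _ (hg k hk i hi hlt c hkc c hc)
  · exact lt_irrefl _ (hg i hi k hk hlt c hc c hkc)

/-- The support of `x` lies in the smallest interval containing the support of `f`. -/
def SupportedInRan (x f : C00) : Prop :=
  ∀ a ∈ x.support, a ∈ ran f

theorem Before.of_supportedInRan {f g x y : C00} (h : Before f g) (hx : SupportedInRan x f)
    (hy : SupportedInRan y g) : Before x y := by
  intro a ha b hb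
  obtain ⟨-, -, a', ha', -, haa⟩ := hx a ha
  obtain ⟨b', hb', -, -, hbb, -⟩ := hy b hb
  exact (haa.trans_lt (h a' ha' b' hb')).trans_le hbb

theorem mem_ran_of_mem_support {f : C00} {a : ℕ+} (h : a ∈ f.support) : a ∈ ran f :=
  ⟨a, h, a, h, le_rfl, le_rfl⟩

theorem supportedInRan_smul_sum {d : ℕ} {y φ : Fin d → C00} (r : ℝ) {θ : ℝ} (hθ : θ ≠ 0)
    (hy : ∀ k l, k < l → Before (y k) (y l)) (hφ : ∀ k, ran (φ k) = ran (y k)) :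
    SupportedInRan (r • ∑ k, y k) (θ • ∑ k, φ k) := by
  have hφs : ∀ k l, k < l → Before (φ k) (φ l) := fun k l hkl =>
    (hy k l hkl).of_supportedInRan (fun a ha => hφ k ▸ mem_ran_of_mem_support ha)
      fun a ha => hφ l ▸ mem_ran_of_mem_support ha
  have hsupp : ∀ k, ∀ c ∈ (φ k).support, c ∈ (θ • ∑ k, φ k).support := by
    intro k c hc
    rw [Finsupp.mem_support_iff] at hc ⊢
    rw [Finsupp.smul_apply, sum_apply_eq_of_successive (fun a _ b _ => hφs a b)
      (Finset.mem_univ k) hc, smul_eq_mul]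
    exact mul_ne_zero hθ hc
  intro a ha
  rw [Finsupp.mem_support_iff, Finsupp.smul_apply, Finsupp.finsetSum_apply] at ha
  obtain ⟨k, -, hk⟩ := Finset.exists_ne_zero_of_sum_ne_zero (right_ne_zero_of_mul ha)
  have h : a ∈ ran (φ k) := hφ k ▸ mem_ran_of_mem_support (Finsupp.mem_support_iff.2 hk)
  obtain ⟨b, hb, c, hc, hbc⟩ := h
  exact ⟨b, hsupp k b hb, c, hsupp k c hc, hbc⟩

theorem supportedInRan_smul_sum_e (F : Finset ℕ+) (r : ℝ) {θ : ℝ} (hθ : θ ≠ 0) :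
    SupportedInRan (r • ∑ k ∈ F, e k) (θ • ∑ k ∈ F, e k) := by
  intro a ha
  refine mem_ran_of_mem_support ?_
  rw [Finsupp.mem_support_iff, Finsupp.smul_apply, smul_eq_mul] at ha ⊢
  exact mul_ne_zero hθ (right_ne_zero_of_mul ha)

theorem getElem?_interleave_odd : ∀ {fs gs : List C00} (_ : fs.length = gs.length) (k : ℕ),
    (interleave fs gs)[2 * k + 1]? = gs[k]?
  | [], gs, h, k => by
    obtain rfl : gs = [] := List.eq_nil_of_length_eq_zero h.symm
    simp [interleave]
  | f :: fs, [], h, k => by simp at h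
  | f :: fs, g :: gs, h, 0 => by simp [interleave]
  | f :: fs, g :: gs, h, k + 1 => by
    have h' : fs.length = gs.length := by simpa using h
    have := getElem?_interleave_odd h' k
    simp only [interleave]
    rw [show 2 * (k + 1) + 1 = (2 * k + 1) + 1 + 1 by ring, List.getElem?_cons_succ,
      List.getElem?_cons_succ, this, List.getElem?_cons_succ]

theorem hat_apply_two_mul (g : C00) (a : ℕ+) : hat g (2 * a) = g a :=
  Finsupp.mapDomain_apply (fun _ _ h => mul_left_cancel h) g a

namespace Choices

variable {P : Choices} {C : ℝ}

theorem IsAverage.mono (hC : 0 ≤ C) {q : ℕ} {ε ε' : ℝ} (h : ε ≤ ε') {x : C00}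
    (hx : P.IsAverage C q ε x) : P.IsAverage C q ε' x := by
  refine ⟨fun c => (hx.apply_le c).trans ?_, fun φ i hi hφ => (hx.light φ i hi hφ).trans ?_,
    fun φ hφ => (hx.same φ hφ).trans ?_, fun φ i hi hφ => (hx.heavy φ i hi hφ).trans ?_⟩ <;>
  gcongr

theorem IsSpecial.weights (hP : P.Valid) {V : Set C00} {L : ℕ → ℕ → Set C00} {N j : ℕ}
    {t : ℕ → ℕ} {f : ℕ → C00}
    (h : P.IsSpecial V L N j (fun k => 2 * t k) ((List.range (2 * P.n (2 * j - 1))).map f))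
    (hf : ∀ k < P.n (2 * j - 1), ∃ F : Finset ℕ+, F.Nonempty ∧ (∀ i ∈ F, Even (i : ℕ)) ∧
      f (2 * k + 1) = (m (2 * t k) : ℝ)⁻¹ • ∑ i ∈ F, e i) :
    P.n (2 * j - 1) ^ 2 ≤ m (2 * t 0) ∧ ∀ k, k + 1 < P.n (2 * j - 1) → t k < t (k + 1) := by
  set n := P.n (2 * j - 1) with hn
  have hn4 : 4 ≤ n := P.four_le_n hP _
  obtain ⟨fs, gs, hs, φs, hF, -, h3, ⟨s1, -⟩, -, -, hφ, hsp⟩ := h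
  have hlen := congrArg List.length hF
  have hφlen := congrArg List.length hφ
  simp only [List.length_map, List.length_range, List.length_append, length_interleave]
    at hlen hφlen
  have hgs : gs.length = n := by omega
  have hfs : fs.length = gs.length := by omega
  obtain rfl : hs = [] := List.eq_nil_of_length_eq_zero (by omega)
  obtain rfl : φs = [] := List.eq_nil_of_length_eq_zero (by simpa using hφlen.symm)
  rw [List.append_nil] at hF hsp
  obtain ⟨-, hQ, -, h0, hσ⟩ := hsp
  have hne : gs ≠ [] := fun h => by rw [h, List.length_nil] at hgs; omega
  refine ⟨?_, fun k hk => ?_⟩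
  · obtain ⟨j₁, -, h1, h2⟩ := h0 hne
    rw [show 2 * t 0 = 2 * j₁ from h1]
    exact h2
  · obtain ⟨-, hQ1, hQ2⟩ := hQ hne
    have hkl : k < gs.length := by omega
    have hget : f (2 * k + 1) = hat gs[k] := by
      have h1 := getElem?_interleave_odd (fs := fs) (gs := gs.map hat) (by simpa using hfs) k
      rw [← hF, List.getElem?_map, List.getElem?_map, List.getElem?_range (by omega),
        List.getElem?_eq_getElem hkl] at h1
      simpa using h1
    obtain ⟨F, ⟨b, hb⟩, hFe, hFf⟩ := hf k (by omega)
    obtain ⟨r, hr⟩ := hFe b hb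
    have hr0 : 0 < r := by have := b.pos; omega
    obtain ⟨a, rfl⟩ : ∃ a : ℕ+, b = 2 * a := by
      refine ⟨r.toPNat hr0, PNat.coe_injective ?_⟩
      rw [hr, PNat.mul_coe]
      change r + r = 2 * r
      ring
    have hm := m_pos_real (2 * t k)
    have hval : gs[k] a = (m (2 * t k) : ℝ)⁻¹ := by
      rw [← hat_apply_two_mul, ← hget, hFf, Finsupp.smul_apply, sum_e_apply, if_pos hb,
        smul_eq_mul, mul_one]
    have hmem : a ∈ gs[k].support := by
      rw [Finsupp.mem_support_iff, hval]
      exact inv_ne_zero hm.ne'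
    obtain ⟨l, htake⟩ : ∃ l, gs.take (k + 1) = l ++ [gs[k]] :=
      ⟨_, (List.take_concat_get' gs k hkl).symm⟩
    have hlarge := hP.σ_large (gs.take (k + 1)) ⟨by rw [htake]; simp,
      fun g hg => hQ1 g (List.mem_of_mem_take hg), hQ2.sublist (List.take_sublist _ _)⟩ gs[k]
      (by rw [htake]; simp) _ hmem gs[k] (by rw [htake]; simp) _ hmem
    rw [← hσ k (by omega), hval, abs_of_pos (inv_pos.2 hm), one_div, inv_inv] at hlarge
    have hr1 : (1 : ℝ) ≤ ((a : ℕ) : ℝ) := by exact_mod_cast a.pos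
    have hlt : (m (2 * t k) : ℝ) < m (2 * t (k + 1)) := by nlinarith
    have := m_strictMono.lt_iff_lt.1 (Nat.cast_lt.1 hlt)
    omega

theorem sixteen_mul_m_pow_le (hP : P.Valid) (p : ℕ) :
    16 * m (p + 1) ^ 3 ≤ P.n (p + 1) ^ 2 := by
  have h1 : m (p + 1) ^ 3 ≤ P.n (p + 1) := by
    refine le_trans ?_ (pow_le_n_succ hP p)
    rw [m_eq, ← pow_mul, mul_comm]
    exact Nat.pow_le_pow_left (by have := P.four_le_n hP p; omega) _
  have h2 : 16 ≤ m (p + 1) ^ 3 := by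
    have h : m 1 ≤ m (p + 1) := m_strictMono.monotone (by omega)
    have h' : m 1 = 32 := rfl
    calc 16 ≤ 32 ^ 3 := by norm_num
      _ ≤ _ := Nat.pow_le_pow_left (h' ▸ h) 3
  calc 16 * m (p + 1) ^ 3 ≤ P.n (p + 1) * P.n (p + 1) := Nat.mul_le_mul (h2.trans h1) h1
    _ = _ := (sq _).symm

/-- The properties of a dependent paired sequence that the basic inequality uses: a block sequence
of averages in which the `k`-th pair has weight `m_{2 t_k}`, with `t_0 < t_1 < ⋯` and
`8 / δ ≤ m_{2 t_0}`. -/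
structure IsPairedAverages (P : Choices) (C : ℝ) (n : ℕ) (δ : ℝ) (t : ℕ → ℕ) (x : ℕ → C00) :
    Prop where
  C_nonneg : 0 ≤ C
  δ_pos : 0 < δ
  average : ∀ k < 2 * n, P.IsAverage C (2 * t (k / 2)) (δ / 8) (x k)
  inv_le : (m (2 * t 0) : ℝ)⁻¹ ≤ δ / 8
  strictMono : ∀ k l, k < l → l < n → t k < t l
  block : ∀ k l, k < l → l < 2 * n → Before (x k) (x l)

theorem IsDependentPaired.isPairedAverages (hP : P.Valid) {j : ℕ} (hj : 1 ≤ j) {x f : ℕ → C00}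
    (h : P.IsDependentPaired C j x f) :
    ∃ t, P.IsPairedAverages C (P.n (2 * j - 1)) ((m (2 * j - 1) : ℝ)⁻¹ ^ 3) t x := by
  obtain ⟨t, hk, N, -, hsp⟩ := h
  set n := P.n (2 * j - 1) with hn
  have hn4 : 4 ≤ n := P.four_le_n hP _
  have hnt : ∀ k, 4 ≤ P.n (2 * t k) := fun k => P.four_le_n hP _
  have hC : 1 ≤ C := (hk 0 (by omega)).2.1.1
  obtain ⟨hm0, ht⟩ := hsp.weights hP fun k hkn => by
    obtain ⟨⟨F, hF, hFe, -, hFf⟩, -⟩ := hk k hkn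
    exact ⟨F, Finset.card_pos.1 (by rw [hF]; have := hnt k; omega), hFe, hFf⟩
  have hmono : ∀ k l, k < l → l < n → t k < t l := by
    intro k l hkl
    induction l, hkl using Nat.le_induction with
    | base => intro hl; exact ht k hl
    | succ l _ ih => intro hl; exact (ih (by omega)).trans (ht l hl)
  have hmpos := m_pos_real (2 * j - 1)
  have hinv0 : (m (2 * t 0) : ℝ)⁻¹ ≤ (m (2 * j - 1) : ℝ)⁻¹ ^ 3 / 16 := by
    have h16 : 16 * m (2 * j - 1) ^ 3 ≤ m (2 * t 0) := by
      obtain ⟨p, hp⟩ : ∃ p, 2 * j - 1 = p + 1 := ⟨2 * j - 2, by omega⟩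
      refine le_trans ?_ hm0
      rw [hp]
      exact sixteen_mul_m_pow_le hP p
    have h16' : (16 * (m (2 * j - 1) : ℝ) ^ 3) ≤ m (2 * t 0) := by exact_mod_cast h16
    calc (m (2 * t 0) : ℝ)⁻¹ ≤ (16 * (m (2 * j - 1) : ℝ) ^ 3)⁻¹ := inv_anti₀ (by positivity) h16'
      _ = _ := by rw [mul_inv, inv_pow]; ring
  have hε : ∀ k < n, 2 * (m (2 * t k) : ℝ)⁻¹ ≤ (m (2 * j - 1) : ℝ)⁻¹ ^ 3 / 8 := by
    intro k hkn
    have h0 : t 0 ≤ t k := by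
      rcases Nat.eq_zero_or_pos k with rfl | hk0
      · exact le_rfl
      · exact (hmono 0 k hk0 hkn).le
    have := inv_m_anti (show 2 * t 0 ≤ 2 * t k by omega)
    linarith
  have hav : ∀ k < n, P.IsAverage C (2 * t k) ((m (2 * j - 1) : ℝ)⁻¹ ^ 3 / 8) (x (2 * k)) ∧
      P.IsAverage C (2 * t k) ((m (2 * j - 1) : ℝ)⁻¹ ^ 3 / 8) (x (2 * k + 1)) ∧
      SupportedInRan (x (2 * k)) (f (2 * k)) ∧
      SupportedInRan (x (2 * k + 1)) (f (2 * k + 1)) := by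
    intro k hkn
    obtain ⟨⟨F, hF, -, hFx, hFf⟩, ⟨-, hq, y, φ, hy, hx, hf, hφ, -⟩, -⟩ := hk k hkn
    have hε := hε k hkn
    have hm := (inv_pos.2 (m_pos_real (2 * t k))).ne'
    refine ⟨?_, ?_, ?_, ?_⟩
    · have h1 := hy.isSpread hP (by linarith)
      obtain ⟨p, hp⟩ : ∃ p, 2 * t k = p + 1 := ⟨2 * t k - 1, by omega⟩
      rw [hx]
      generalize 2 * t k = q at *
      subst hp
      exact (h1.isAverage hP).mono (by linarith) hε
    · have h1 := isSpread_e hP hC (F.orderEmbOfFin hF).strictMono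
      have h2 : ∑ i, e (F.orderEmbOfFin hF i) = ∑ i ∈ F, e i := by
        rw [← Finset.sum_coe_sort F]
        exact Equiv.sum_comp (F.orderIsoOfFin hF).toEquiv fun i : F => e i
      obtain ⟨p, hp⟩ : ∃ p, 2 * t k = p + 1 := ⟨2 * t k - 1, by omega⟩
      rw [hFx, ← h2]
      generalize 2 * t k = q at *
      subst hp
      exact (h1.isAverage hP).mono (by linarith) hε
    · rw [hx, hf]
      exact supportedInRan_smul_sum _ hm hy.2.1 fun i => (hφ i).2.2
    · rw [hFx, hFf]
      exact supportedInRan_smul_sum_e F _ hm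
  have hpar : ∀ k < 2 * n, k / 2 < n ∧ (k = 2 * (k / 2) ∨ k = 2 * (k / 2) + 1) := by
    intro k hk; omega
  refine ⟨t, by linarith, by positivity, fun k hk => ?_, ?_, hmono, fun k l hkl hl => ?_⟩
  · obtain ⟨hk2, h | h⟩ := hpar k hk
    · have := (hav _ hk2).1
      rwa [← h] at this
    · have := (hav _ hk2).2.1
      rwa [← h] at this
  · have : (0 : ℝ) < (m (2 * j - 1) : ℝ)⁻¹ ^ 3 := by positivity
    linarith
  · have hsupp : ∀ k < 2 * n, SupportedInRan (x k) (f k) := by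
      intro k hk
      obtain ⟨hk2, h | h⟩ := hpar k hk
      · have := (hav _ hk2).2.2.1
        rwa [← h] at this
      · have := (hav _ hk2).2.2.2
        rwa [← h] at this
    obtain ⟨_, _, _, _, _, hF, _⟩ := hsp
    have hb : Before (f k) (f l) := by
      have := List.pairwise_iff_getElem.1 hF k l (by simp; omega) (by simp; omega) hkl
      simpa using this
    exact hb.of_supportedInRan (hsupp k (by omega)) (hsupp l hl)

end Choices
end HIExt

namespace HIExt

/-! ### Functionals with a tree analysis that avoids given weights -/

/-- The functionals that have a tree analysis without nodes of weight `m_i`, `i ∈ J`. -/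
def treeSet (a : ℕ → ℕ) (J : Set ℕ) : Set C00 :=
  {h | ∃ T : FTree, T.IsAnalysis a ∧ T.value = h ∧ Disjoint T.weights J}

theorem e_mem_treeSet (a : ℕ → ℕ) (J : Set ℕ) (k : ℕ+) : e k ∈ treeSet a J :=
  ⟨.leaf (e k), ⟨k, .inl rfl⟩, rfl, Set.empty_disjoint J⟩

theorem zero_mem_treeSet (a : ℕ → ℕ) (J : Set ℕ) : (0 : C00) ∈ treeSet a J := by
  refine ⟨.conv (fun _ : Fin 2 => 1 / 2) ![.leaf (e 1), .leaf (-e 1)], ⟨?_, ?_, ?_⟩, ?_, ?_⟩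
  · intro i; norm_num
  · norm_num
  · intro i
    fin_cases i
    · exact ⟨1, .inl rfl⟩
    · exact ⟨1, .inr rfl⟩
  · simp [FTree.value, Fin.sum_univ_two]
  · refine Set.disjoint_left.2 fun w hw => ?_
    obtain ⟨i, hi⟩ := Set.mem_iUnion.1 hw
    fin_cases i <;> exact absurd hi (Set.notMem_empty w)

theorem FTree.IsAnalysis.value_mem {a : ℕ → ℕ} {T : FTree} (h : T.IsAnalysis a) :
    T.value ∈ normingSet a := by
  intro S hS
  induction T with
  | leaf f => exact IsMTClosed.unit hS h
  | op j child ih =>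
    obtain ⟨h1, h2, h3, h4⟩ := h
    exact IsMTClosed.op hS j _ ⟨_, _, h1, h2, fun i => ih i (h4 i), h3, rfl⟩
  | conv r child ih =>
    obtain ⟨h1, h2, h3⟩ := h
    exact IsMTClosed.conv hS ⟨_, r, _, h1, h2, fun i => ih i (h3 i), rfl⟩

theorem treeSet_subset_normingSet (a : ℕ → ℕ) (J : Set ℕ) : treeSet a J ⊆ normingSet a := by
  rintro _ ⟨T, hT, rfl, -⟩
  exact hT.value_mem

theorem exists_op_tree {a : ℕ → ℕ} {J : Set ℕ} {i : ℕ} (hi : i ∉ J) {h : C00}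
    (hh : IsOp (treeSet a J) (a i) (m i : ℝ)⁻¹ h) :
    ∃ (d : ℕ) (child : Fin d → FTree), (FTree.op i child).IsAnalysis a ∧
      (FTree.op i child).value = h ∧ Disjoint (FTree.op i child).weights J := by
  obtain ⟨d, g, h1, h2, h3, h4, rfl⟩ := hh
  choose T hT hv hw using h3
  obtain rfl : (fun k => (T k).value) = g := funext hv
  refine ⟨d, T, ⟨h1, h2, h4, hT⟩, rfl, ?_⟩
  refine Set.disjoint_left.2 fun w hwT hwJ => ?_
  rcases hwT with rfl | hwT
  · exact hi hwJ
  · obtain ⟨k, hk⟩ := Set.mem_iUnion.1 hwT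
    exact Set.disjoint_left.1 (hw k) hk hwJ

theorem op_mem_treeSet {a : ℕ → ℕ} {J : Set ℕ} {i : ℕ} (hi : i ∉ J) {h : C00}
    (hh : IsOp (treeSet a J) (a i) (m i : ℝ)⁻¹ h) : h ∈ treeSet a J := by
  obtain ⟨d, child, h1, h2, h3⟩ := exists_op_tree hi hh
  exact ⟨_, h1, h2, h3⟩

/-! ### Families of successive non-negative functionals -/

/-- A family of nonzero successive elements of `S` with non-negative coordinates, supported in
`{k + 1 : k ∈ E}`. -/
structure IsPieces (S : Set C00) (E : Finset ℕ) (U : Finset C00) : Prop where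
  mem : ∀ u ∈ U, u ∈ S
  nonneg : ∀ u ∈ U, ∀ c, 0 ≤ u c
  ne_zero : ∀ u ∈ U, u ≠ 0
  supp : ∀ u ∈ U, ∀ c ∈ u.support, ∃ k ∈ E, c = k.succPNat
  comparable : ∀ u ∈ U, ∀ v ∈ U, u ≠ v → Before u v ∨ Before v u

theorem isPieces_empty (S : Set C00) (E : Finset ℕ) : IsPieces S E ∅ := by
  constructor <;> simp

theorem isPieces_singleton {S : Set C00} {E : Finset ℕ} {u : C00} (h : u ∈ S)
    (h0 : ∀ c, 0 ≤ u c) (hne : u ≠ 0) (hs : ∀ c ∈ u.support, ∃ k ∈ E, c = k.succPNat) :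
    IsPieces S E {u} := by
  refine ⟨?_, ?_, ?_, ?_, fun v hv w hw hvw => ?_⟩
  iterate 4 exact fun v hv => by rw [Finset.mem_singleton.1 hv]; assumption
  exact absurd ((Finset.mem_singleton.1 hv).trans (Finset.mem_singleton.1 hw).symm) hvw

theorem isPieces_image_e {S : Set C00} (hS : ∀ k, e k ∈ S) {E B : Finset ℕ} (hB : B ⊆ E)
    [DecidableEq C00] : IsPieces S E (B.image fun k => e k.succPNat) := by
  have h : ∀ u ∈ B.image fun k : ℕ => e k.succPNat, ∃ k ∈ B, u = e k.succPNat := fun u hu => by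
    obtain ⟨k, hk, rfl⟩ := Finset.mem_image.1 hu
    exact ⟨k, hk, rfl⟩
  refine ⟨fun u hu => ?_, fun u hu => ?_, fun u hu => ?_, fun u hu c hc => ?_,
    fun u hu v hv => ?_⟩ <;> obtain ⟨k, hk, rfl⟩ := h u hu
  · exact hS _
  · exact e_nonneg _
  · exact e_ne_zero _
  · rw [e_support, Finset.mem_singleton] at hc
    exact ⟨k, hB hk, hc⟩
  · obtain ⟨l, -, rfl⟩ := h v hv
    exact e_comparable ⟨_, rfl⟩ ⟨_, rfl⟩

theorem before_of_positions {A B : Finset ℕ} (hAB : ∀ k ∈ A, ∀ l ∈ B, k < l) {u v : C00}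
    (hu : ∀ c ∈ u.support, ∃ k ∈ A, c = k.succPNat)
    (hv : ∀ c ∈ v.support, ∃ k ∈ B, c = k.succPNat) : Before u v := by
  intro c hc c' hc'
  obtain ⟨k, hk, rfl⟩ := hu c hc
  obtain ⟨l, hl, rfl⟩ := hv c' hc'
  exact Nat.succPNat_lt_succPNat.2 (hAB k hk l hl)

theorem IsPieces.sum_nonneg {S : Set C00} {E : Finset ℕ} {U : Finset C00} (hU : IsPieces S E U)
    (c : ℕ+) : 0 ≤ (∑ u ∈ U, u) c := by
  rw [Finsupp.finsetSum_apply]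
  exact Finset.sum_nonneg fun u hu => hU.nonneg u hu c

theorem IsPieces.sum_apply_le {S : Set C00} {E : Finset ℕ} {U U' : Finset C00}
    (hU : IsPieces S E U) (h : U' ⊆ U) (c : ℕ+) : (∑ u ∈ U', u) c ≤ (∑ u ∈ U, u) c := by
  rw [Finsupp.finsetSum_apply, Finsupp.finsetSum_apply]
  exact Finset.sum_le_sum_of_subset_of_nonneg h fun u hu _ => hU.nonneg u hu c

theorem IsPieces.one_le_sum {S : Set C00} {E : Finset ℕ} {U : Finset C00} (hU : IsPieces S E U)
    {c : ℕ+} (h : e c ∈ U) : 1 ≤ (∑ u ∈ U, u) c := by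
  have := hU.sum_apply_le (Finset.singleton_subset_iff.2 h) c
  rwa [Finset.sum_singleton, e_apply_self] at this

theorem IsPieces.isOp {S : Set C00} (hS : (0 : C00) ∈ S) {E : Finset ℕ} {U : Finset C00}
    (hU : IsPieces S E U) {a : ℕ} (ha : 1 ≤ a) (hc : U.card ≤ a) (θ : ℝ) :
    IsOp S a θ (θ • ∑ u ∈ U, u) := by
  rcases U.eq_empty_or_nonempty with rfl | hne
  · exact ⟨1, fun _ => 0, le_rfl, ha, fun _ => hS, fun i k hik => by omega, by simp⟩
  · exact isOp_finset_sum θ hne hc hU.mem hU.ne_zero hU.comparable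

theorem IsPieces.sum_supp {S : Set C00} {E : Finset ℕ} {U : Finset C00} (hU : IsPieces S E U)
    (θ : ℝ) : ∀ c ∈ (θ • ∑ u ∈ U, u).support, ∃ k ∈ E, c = k.succPNat := by
  intro c hc
  rw [Finsupp.mem_support_iff, Finsupp.smul_apply, Finsupp.finsetSum_apply] at hc
  obtain ⟨u, hu, hk⟩ := Finset.exists_ne_zero_of_sum_ne_zero (right_ne_zero_of_mul hc)
  exact hU.supp u hu c (Finsupp.mem_support_iff.2 hk)

namespace Choices

variable {P : Choices} {C : ℝ} {n : ℕ} {δ : ℝ} {t : ℕ → ℕ} {x : ℕ → C00}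

/-! ### The basic inequality -/

theorem abs_pair_sum_le (φ : C00) (E : Finset ℕ) (lam : ℕ → ℝ) (x : ℕ → C00) {w : ℕ → ℝ}
    (h : ∀ k ∈ E, |pair φ (x k)| ≤ C * w k) :
    |pair φ (∑ k ∈ E, lam k • x k)| ≤ C * ∑ k ∈ E, w k * |lam k| := by
  rw [pair_sum_right, Finset.mul_sum]
  refine (Finset.abs_sum_le_sum_abs _ _).trans (Finset.sum_le_sum fun k hk => ?_)
  rw [pair_smul_right, abs_mul, ← mul_assoc, mul_comm]
  exact mul_le_mul_of_nonneg_right (h k hk) (abs_nonneg _)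

theorem IsPairedAverages.abs_pair_le_of_heavy (hx : P.IsPairedAverages C n δ t x)
    {φ : C00} {i : ℕ} (hφ : P.HasWeight φ i) (hi : 2 * t 0 ≤ i) {k : ℕ} (hk : k < 2 * n) :
    |pair φ (x k)| ≤ C * ((if 2 * t (k / 2) = i then 1 else 0) + δ / 2) := by
  have hav := hx.average k hk
  have hδ := hx.δ_pos
  have hC := hx.C_nonneg
  rcases lt_trichotomy (2 * t (k / 2)) i with h | h | h
  · rw [if_neg h.ne, zero_add]
    refine (hav.heavy φ i h hφ).trans (mul_le_mul_of_nonneg_left (by linarith) hC)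
  · rw [if_pos h]
    subst h
    exact (hav.same φ hφ).trans (mul_le_mul_of_nonneg_left (by linarith) hC)
  · rw [if_neg h.ne', zero_add]
    have h1 := inv_m_anti hi
    have h2 := hx.inv_le
    exact (hav.light φ i h hφ).trans (mul_le_mul_of_nonneg_left (by linarith) hC)

theorem IsPairedAverages.le (hx : P.IsPairedAverages C n δ t x) {k : ℕ} (hk : k < 2 * n) :
    2 * t 0 ≤ 2 * t (k / 2) := by
  rcases Nat.eq_zero_or_pos (k / 2) with h | h
  · rw [h]
  · have := hx.strictMono 0 (k / 2) h (by omega)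
    omega

theorem IsPairedAverages.half_eq (hx : P.IsPairedAverages C n δ t x) {k l : ℕ} (hk : k < 2 * n)
    (hl : l < 2 * n) (h : 2 * t (k / 2) = 2 * t (l / 2)) : k / 2 = l / 2 := by
  rcases lt_trichotomy (k / 2) (l / 2) with hlt | heq | hlt
  · have := hx.strictMono _ _ hlt (by omega); omega
  · exact heq
  · have := hx.strictMono _ _ hlt (by omega); omega

/-- The functional `φ` is majorized on every interval by a sum of at most two successive elements
of `S`, up to `δ`. -/
def IsMajorized (S : Set C00) (C : ℝ) (n : ℕ) (δ : ℝ) (x : ℕ → C00) (lam : ℕ → ℝ)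
    (φ : C00) : Prop :=
  ∀ E ⊆ Finset.range (2 * n), (∀ k ∈ E, ∀ l ∈ E, ∀ i, k ≤ i → i ≤ l → i ∈ E) →
    ∃ U, IsPieces S E U ∧ U.card ≤ 2 ∧ |pair φ (∑ k ∈ E, lam k • x k)| ≤
      C * ∑ k ∈ E, ((∑ u ∈ U, u) k.succPNat + δ) * |lam k|

theorem IsPairedAverages.exists_pieces_of_light (hx : P.IsPairedAverages C n δ t x)
    {lam : ℕ → ℝ} {S : Set C00} (hS : ∀ k, e k ∈ S) {φ : C00} {i : ℕ} (hφ : P.HasWeight φ i)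
    (hi : i < 2 * t 0) {d : ℕ} {g : Fin d → C00} (hg : ∀ a, IsMajorized S C n δ x lam (g a))
    (hs : ∀ a b, a < b → Before (g a) (g b)) (hφg : φ = (m i : ℝ)⁻¹ • ∑ a, g a) {E : Finset ℕ}
    (hE : E ⊆ Finset.range (2 * n)) (hconn : ∀ k ∈ E, ∀ l ∈ E, ∀ i, k ≤ i → i ≤ l → i ∈ E) :
    ∃ U, IsPieces S E U ∧ U.card ≤ 3 * d ∧ |pair φ (∑ k ∈ E, lam k • x k)| ≤
      C * ∑ k ∈ E, ((m i : ℝ)⁻¹ * (∑ u ∈ U, u) k.succPNat + δ / 2) * |lam k| := by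
  classical
  have hC := hx.C_nonneg
  have hδ := hx.δ_pos
  have hlt : ∀ k ∈ E, k < 2 * n := fun k hk => Finset.mem_range.1 (hE hk)
  obtain ⟨T, A, hT, hTd, hA, hAT, hAA, hAc, hsum⟩ :=
    exists_splitting x E (fun k _ l hl hkl => hx.block k l hkl (hlt l hl)) g hs
  choose V hV hVc hVb using fun a => hg a (A a) ((hA a).trans hE) fun k hk l hl i hki hil =>
    hAc a k hk l hl i (hconn k (hA a hk) l (hA a hl) i hki hil) hki hil
  have hTp := isPieces_image_e hS (E := T) subset_rfl
  set TU := T.image fun k : ℕ => e k.succPNat with hTU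
  set U := Finset.univ.biUnion V ∪ TU with hUdef
  have hcases : ∀ u ∈ U, (∃ a, u ∈ V a) ∨ u ∈ TU := by
    intro u hu
    rcases Finset.mem_union.1 hu with h | h
    · obtain ⟨a, -, ha⟩ := Finset.mem_biUnion.1 h
      exact .inl ⟨a, ha⟩
    · exact .inr h
  have hVT : ∀ a, ∀ u ∈ V a, ∀ v ∈ TU, Before u v ∨ Before v u := by
    intro a u hu v hv
    obtain ⟨s, hs, rfl⟩ := Finset.mem_image.1 hv
    have hsupp : ∀ c ∈ (e s.succPNat).support, ∃ k ∈ ({s} : Finset ℕ), c = k.succPNat := by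
      intro c hc
      rw [e_support, Finset.mem_singleton] at hc
      exact ⟨s, Finset.mem_singleton_self s, hc⟩
    rcases hAT a s hs with h | h
    · exact .inr (before_of_positions (by simpa using h) hsupp ((hV a).supp u hu))
    · exact .inl (before_of_positions (by simpa using h) ((hV a).supp u hu) hsupp)
  have hU : IsPieces S E U := by
    refine ⟨fun u hu => ?_, fun u hu => ?_, fun u hu => ?_, fun u hu c hc => ?_,
      fun u hu v hv huv => ?_⟩ <;> rcases hcases u hu with ⟨a, hu⟩ | hu
    · exact (hV a).mem u hu
    · exact hTp.mem u hu
    · exact (hV a).nonneg u hu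
    · exact hTp.nonneg u hu
    · exact (hV a).ne_zero u hu
    · exact hTp.ne_zero u hu
    · obtain ⟨k, hk, h⟩ := (hV a).supp u hu c hc
      exact ⟨k, hA a hk, h⟩
    · obtain ⟨k, hk, h⟩ := hTp.supp u hu c hc
      exact ⟨k, hT hk, h⟩
    · rcases hcases v hv with ⟨b, hv⟩ | hv
      · rcases lt_trichotomy a b with h | rfl | h
        · exact .inl (before_of_positions (hAA a b h) ((hV a).supp u hu) ((hV b).supp v hv))
        · exact (hV a).comparable u hu v hv huv
        · exact .inr (before_of_positions (hAA b a h) ((hV b).supp v hv) ((hV a).supp u hu))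
      · exact hVT a u hu v hv
    · rcases hcases v hv with ⟨b, hv⟩ | hv
      · exact (hVT b v hv u hu).symm
      · exact hTp.comparable u hu v hv huv
  refine ⟨U, hU, ?_, ?_⟩
  · have h1 : (Finset.univ.biUnion V).card ≤ d * 2 := by
      refine (Finset.card_biUnion_le).trans ((Finset.sum_le_sum fun a _ => hVc a).trans ?_)
      simp
    have h2 : TU.card ≤ d := Finset.card_image_le.trans hTd
    exact (Finset.card_union_le _ _).trans (by omega)
  · have hm := inv_pos.2 (m_pos_real i)
    have hm2 := inv_m_le_half i
    set w : ℕ → ℝ := fun k => ((m i : ℝ)⁻¹ * (∑ u ∈ U, u) k.succPNat + δ / 2) * |lam k| with hw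
    have hw0 : ∀ k ∈ E, 0 ≤ w k := fun k _ =>
      mul_nonneg (add_nonneg (mul_nonneg hm.le (hU.sum_nonneg _)) (by linarith)) (abs_nonneg _)
    have hAb : ∀ a, (m i : ℝ)⁻¹ * |pair (g a) (∑ k ∈ A a, lam k • x k)| ≤
        C * ∑ k ∈ A a, w k := by
      intro a
      refine (mul_le_mul_of_nonneg_left (hVb a) hm.le).trans ?_
      rw [mul_left_comm, Finset.mul_sum]
      refine mul_le_mul_of_nonneg_left (Finset.sum_le_sum fun k _ => ?_) hC
      rw [← mul_assoc, mul_add]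
      have hsub : V a ⊆ U := (Finset.subset_biUnion_of_mem V (Finset.mem_univ a)).trans
        Finset.subset_union_left
      have h1 := mul_le_mul_of_nonneg_left (hU.sum_apply_le hsub k.succPNat) hm.le
      have h2 := mul_le_mul_of_nonneg_right hm2 hδ.le
      exact mul_le_mul_of_nonneg_right (by linarith) (abs_nonneg _)
    have hTb : ∀ k ∈ T, |lam k * pair φ (x k)| ≤ C * w k := by
      intro k hk
      have hkn := hlt k (hT hk)
      have h1 := (hx.average k hkn).light φ i (hi.trans_le (hx.le hkn)) hφ
      have h2 : 1 ≤ (∑ u ∈ U, u) k.succPNat := hU.one_le_sum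
        (Finset.mem_union_right _ (Finset.mem_image_of_mem _ hk))
      have h3 : |pair φ (x k)| ≤ C * ((m i : ℝ)⁻¹ * (∑ u ∈ U, u) k.succPNat + δ / 2) := by
        refine h1.trans (mul_le_mul_of_nonneg_left ?_ hC)
        nlinarith
      rw [abs_mul, mul_comm, hw, ← mul_assoc]
      exact mul_le_mul_of_nonneg_right h3 (abs_nonneg _)
    have heq : pair φ (∑ k ∈ E, lam k • x k) =
        ∑ a, (m i : ℝ)⁻¹ * pair (g a) (∑ k ∈ A a, lam k • x k) +
          ∑ k ∈ T, lam k * pair φ (x k) := by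
      simp only [hφg, pair_smul_left]
      rw [hsum lam, mul_add, Finset.mul_sum, Finset.mul_sum]
      congr 1
      exact Finset.sum_congr rfl fun k _ => by ring
    calc |pair φ (∑ k ∈ E, lam k • x k)|
        ≤ ∑ a, |(m i : ℝ)⁻¹ * pair (g a) (∑ k ∈ A a, lam k • x k)| +
            ∑ k ∈ T, |lam k * pair φ (x k)| := by
          rw [heq]
          exact (abs_add_le _ _).trans (add_le_add (Finset.abs_sum_le_sum_abs _ _)
            (Finset.abs_sum_le_sum_abs _ _))
      _ ≤ ∑ a, C * ∑ k ∈ A a, w k + ∑ k ∈ T, C * w k := by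
          refine add_le_add (Finset.sum_le_sum fun a _ => ?_) (Finset.sum_le_sum hTb)
          rw [abs_mul, abs_of_pos hm]
          exact hAb a
      _ = C * (∑ a, ∑ k ∈ A a, w k + ∑ k ∈ T, w k) := by
          rw [mul_add, Finset.mul_sum, Finset.mul_sum]
      _ ≤ C * ∑ k ∈ E, w k :=
          mul_le_mul_of_nonneg_left (sum_sum_le_of_ordered hA hAA hT hAT hw0) hC

/-- The additional hypothesis of the basic inequality, for the functionals of weight `m_i`. -/
def IsNegligibleWeight (P : Choices) (C : ℝ) (n : ℕ) (δ : ℝ) (x : ℕ → C00) (lam : ℕ → ℝ)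
    (i : ℕ) : Prop :=
  ∀ g : C00, P.HasWeight g i → ∀ a b : ℕ, b ≤ 2 * n →
    |pair g (∑ k ∈ Finset.Ico a b, lam k • x k)| ≤
      C * ((((Finset.Ico a b).sup fun k => ‖lam k‖₊ : NNReal) : ℝ) +
        δ * ∑ k ∈ Finset.Ico a b, |lam k|)

theorem IsNegligibleWeight.isMajorized {lam : ℕ → ℝ} {S : Set C00} (hS : ∀ k, e k ∈ S)
    {i : ℕ} (hi : P.IsNegligibleWeight C n δ x lam i) {φ : C00} (hφ : P.HasWeight φ i) :
    IsMajorized S C n δ x lam φ := by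
  intro E hE hconn
  rcases E.eq_empty_or_nonempty with rfl | hne
  · exact ⟨∅, isPieces_empty _ _, by simp, by simp [pair]⟩
  · have hEI : E = Finset.Ico (E.min' hne) (E.max' hne + 1) := by
      ext k
      rw [Finset.mem_Ico, Nat.lt_succ_iff]
      exact ⟨fun hk => ⟨E.min'_le k hk, E.le_max' k hk⟩,
        fun hk => hconn _ (E.min'_mem hne) _ (E.max'_mem hne) k hk.1 hk.2⟩
    have hb : E.max' hne + 1 ≤ 2 * n := Finset.mem_range.1 (hE (E.max'_mem hne))
    have h := hi φ hφ (E.min' hne) (E.max' hne + 1) hb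
    rw [← hEI] at h
    obtain ⟨k₀, hk₀, hsup⟩ := Finset.exists_mem_eq_sup E hne fun k => ‖lam k‖₊
    rw [hsup, coe_nnnorm, Real.norm_eq_abs] at h
    refine ⟨{e k₀.succPNat}, isPieces_singleton (hS _) (e_nonneg _) (e_ne_zero _) ?_, by simp, ?_⟩
    · intro c hc
      rw [e_support, Finset.mem_singleton] at hc
      exact ⟨k₀, hk₀, hc⟩
    · have hsum : ∑ k ∈ E, ((∑ u ∈ {e k₀.succPNat}, u) k.succPNat + δ) * |lam k| =
          |lam k₀| + δ * ∑ k ∈ E, |lam k| := by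
        simp only [Finset.sum_singleton, e_apply, add_mul, Finset.sum_add_distrib,
          Nat.succPNat_inj, ite_mul, one_mul, zero_mul, Finset.mul_sum]
        rw [Finset.sum_ite_eq, if_pos hk₀]
      rw [hsum]
      exact h

theorem IsPairedAverages.isMajorized (hP : P.Valid) (hx : P.IsPairedAverages C n δ t x)
    {lam : ℕ → ℝ} {J : Set ℕ} (hJ : ∀ i ∈ J, P.IsNegligibleWeight C n δ x lam i) :
    ∀ φ ∈ P.Wex, IsMajorized (treeSet (fun r => 12 * P.n r) J) C n δ x lam φ := by
  classical
  have hC := hx.C_nonneg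
  have hδ := hx.δ_pos
  set S := treeSet (fun r => 12 * P.n r) J with hS
  have hSe : ∀ k, e k ∈ S := e_mem_treeSet _ _
  refine Wex_induction hP ?_ ?_ ?_ ?_ ?_
  · intro E _ _
    refine ⟨∅, isPieces_empty _ _, by simp, ?_⟩
    rw [pair_zero_left, abs_zero]
    refine mul_nonneg hC (Finset.sum_nonneg fun k _ => ?_)
    simp only [Finset.sum_empty, Finsupp.coe_zero, Pi.zero_apply, zero_add]
    positivity
  · intro c E hE _
    refine ⟨∅, isPieces_empty _ _, by simp, ?_⟩
    refine abs_pair_sum_le _ _ _ _ fun k hk => ?_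
    rw [pair_e_left, Finset.sum_empty, Finsupp.coe_zero, Pi.zero_apply, zero_add]
    exact ((hx.average k (Finset.mem_range.1 (hE hk))).apply_le c).trans
      (mul_le_mul_of_nonneg_left (by linarith) hC)
  · intro f _ hf E hE hconn
    obtain ⟨U, hU, hc, hb⟩ := hf E hE hconn
    exact ⟨U, hU, hc, by rwa [pair_neg_left, abs_neg]⟩
  · intro f i d g hf hd1 hd hg hs hfg
    by_cases hiJ : i ∈ J
    · exact (hJ i hiJ).isMajorized hSe hf
    intro E hE hconn
    by_cases hi : i < 2 * t 0
    · obtain ⟨U, hU, hc, hb⟩ := hx.exists_pieces_of_light hSe hf hi (fun a => (hg a).2) hs hfg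
        hE hconn
      have hn4 := P.four_le_n hP i
      have hm := inv_pos.2 (m_pos_real i)
      set h := (m i : ℝ)⁻¹ • ∑ u ∈ U, u with hh
      have hhS : h ∈ S := op_mem_treeSet hiJ
        (hU.isOp (zero_mem_treeSet _ _) (a := 12 * P.n i) (by omega) (by omega) _)
      have hb' : |pair f (∑ k ∈ E, lam k • x k)| ≤
          C * ∑ k ∈ E, (h k.succPNat + δ) * |lam k| := by
        refine hb.trans (mul_le_mul_of_nonneg_left (Finset.sum_le_sum fun k _ =>
          mul_le_mul_of_nonneg_right ?_ (abs_nonneg _)) hC)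
        rw [hh, Finsupp.smul_apply, smul_eq_mul]
        linarith
      by_cases h0 : h = 0
      · refine ⟨∅, isPieces_empty _ _, by simp, ?_⟩
        rwa [h0] at hb'
      · refine ⟨{h}, isPieces_singleton hhS (fun c => ?_) h0 (hU.sum_supp _), by simp, ?_⟩
        · rw [hh, Finsupp.smul_apply, smul_eq_mul]
          exact mul_nonneg hm.le (hU.sum_nonneg c)
        · rwa [Finset.sum_singleton]
    · set B := E.filter fun k => 2 * t (k / 2) = i with hB
      have hU : IsPieces S E (B.image fun k : ℕ => e k.succPNat) :=
        isPieces_image_e hSe (Finset.filter_subset _ _)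
      refine ⟨_, hU, Finset.card_image_le.trans ?_, ?_⟩
      · rcases B.eq_empty_or_nonempty with h | ⟨l, hl⟩
        · rw [h]; simp
        · have hsub : B ⊆ {2 * (l / 2), 2 * (l / 2) + 1} := by
            intro k hk
            obtain ⟨hkE, hk⟩ := Finset.mem_filter.1 hk
            obtain ⟨hlE, hl⟩ := Finset.mem_filter.1 hl
            have := hx.half_eq (Finset.mem_range.1 (hE hkE)) (Finset.mem_range.1 (hE hlE))
              (hk.trans hl.symm)
            rw [Finset.mem_insert, Finset.mem_singleton]
            omega
          exact (Finset.card_le_card hsub).trans Finset.card_le_two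
      · refine abs_pair_sum_le _ _ _ _ fun k hk => ?_
        refine (hx.abs_pair_le_of_heavy hf (by omega) (Finset.mem_range.1 (hE hk))).trans
          (mul_le_mul_of_nonneg_left ?_ hC)
        have h0 := hU.sum_nonneg k.succPNat
        split_ifs with hki
        · have := hU.one_le_sum
            (Finset.mem_image_of_mem _ (Finset.mem_filter.2 ⟨hk, hki⟩ : k ∈ B))
          linarith
        · linarith
  · intro f hf E hE hconn
    obtain ⟨g, hg, hfg⟩ := exists_abs_pair_le_of_mem_convQ hf (∑ k ∈ E, lam k • x k)
    obtain ⟨U, hU, hc, hb⟩ := hg.2 E hE hconn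
    exact ⟨U, hU, hc, hfg.trans hb⟩

theorem pair_sum_e_succPNat (g : C00) (N : ℕ) (lam : ℕ → ℝ) :
    pair g (∑ k ∈ Finset.range N, |lam k| • e k.succPNat) =
      ∑ k ∈ Finset.range N, g k.succPNat * |lam k| := by
  rw [pair_sum_right]
  refine Finset.sum_congr rfl fun k _ => ?_
  rw [pair_smul_right, pair_e_right, mul_comm]

theorem sum_smul_e_succPNat_apply (r : ℝ) (N : ℕ) (c : ℕ+) :
    (r • ∑ k ∈ Finset.range N, e k.succPNat) c = if c.natPred < N then r else 0 := by
  rw [Finsupp.smul_apply, Finsupp.finsetSum_apply, smul_eq_mul]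
  have h : ∀ k : ℕ, e k.succPNat c = if k = c.natPred then 1 else 0 := by
    intro k
    rw [e_apply]
    refine if_congr ⟨fun h => by rw [← h, Nat.natPred_succPNat], fun h => ?_⟩ rfl rfl
    rw [h, PNat.succPNat_natPred]
  rw [Finset.sum_congr rfl fun k _ => h k, Finset.sum_ite_eq']
  simp only [Finset.mem_range, mul_ite, mul_one, mul_zero]

/-- The basic inequality for a block sequence of paired averages. -/
theorem IsPairedAverages.exists_isMajorant (hP : P.Valid) {j : ℕ}
    (hx : P.IsPairedAverages C (P.n (2 * j - 1)) ((m (2 * j - 1) : ℝ)⁻¹ ^ 3) t x)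
    {lam : ℕ → ℝ} {J : Set ℕ}
    (hJ : ∀ i ∈ J, P.IsNegligibleWeight C (P.n (2 * j - 1)) ((m (2 * j - 1) : ℝ)⁻¹ ^ 3) x lam i)
    {φ : C00} {i : ℕ} (hφ : P.HasWeight φ i) (hi : i ∉ J) :
    ∃ g₁ g₂ h₁ : C00, P.IsMajorant C j x lam φ i g₁ g₂ h₁ ∧
      ∃ (d : ℕ) (child : Fin d → FTree), (FTree.op i child).IsAnalysis (fun r => 12 * P.n r) ∧
        (FTree.op i child).value = h₁ ∧ Disjoint (FTree.op i child).weights J := by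
  classical
  set n := P.n (2 * j - 1) with hn
  set δ := (m (2 * j - 1) : ℝ)⁻¹ ^ 3 with hδdef
  have hC := hx.C_nonneg
  have hδ := hx.δ_pos
  set S := treeSet (fun r => 12 * P.n r) J with hS
  have hni := P.four_le_n hP i
  suffices h : ∃ g₁ h₁ : C00, (∀ k, 0 ≤ g₁ k) ∧ IsOp S (12 * P.n i) (m i : ℝ)⁻¹ h₁ ∧
      (g₁ = h₁ ∨ (∃ k, k ∉ h₁.support ∧ g₁ = e k + h₁) ∨
        ∃ k, k ∉ h₁.support ∧ k + 1 ∉ h₁.support ∧ g₁ = e k + e (k + 1) + h₁) ∧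
      |pair φ (∑ k ∈ Finset.range (2 * n), lam k • x k)| ≤
        C * ∑ k ∈ Finset.range (2 * n), (g₁ k.succPNat + δ / 2) * |lam k| by
    obtain ⟨g₁, h₁, hg₁, hop, hform, hb⟩ := h
    have hSsub : S ⊆ P.Waux2 := treeSet_subset_normingSet _ _
    refine ⟨g₁, (δ / 2) • ∑ k ∈ Finset.range (2 * n), e k.succPNat, h₁,
      ⟨hg₁, fun c => ?_, fun c => ?_, hSsub (op_mem_treeSet hi hop), hop.mono hSsub le_rfl,
        hform, hb.trans (le_of_eq ?_)⟩, exists_op_tree hi hop⟩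
    · rw [sum_smul_e_succPNat_apply]
      split_ifs <;> linarith
    · rw [sum_smul_e_succPNat_apply]
      split_ifs
      · rw [abs_of_pos (by linarith)]; linarith
      · rwa [abs_zero]
    · rw [pair_sum_e_succPNat]
      congr 1
      refine Finset.sum_congr rfl fun k hk => ?_
      rw [Finsupp.add_apply, sum_smul_e_succPNat_apply, Nat.natPred_succPNat,
        if_pos (Finset.mem_range.1 hk)]
  by_cases hit : i < 2 * t 0
  · obtain ⟨d, g, hd1, hd, hg, hs, hφg⟩ := hφ.isOp hP
    obtain ⟨U, hU, hc, hb⟩ := hx.exists_pieces_of_light (E := Finset.range (2 * n))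
      (lam := lam) (e_mem_treeSet (fun r => 12 * P.n r) J) hφ hit
      (fun a => hx.isMajorized hP hJ _ (hg a)) hs hφg subset_rfl
      (fun k _ l hl i _ hil => by rw [Finset.mem_range] at hl ⊢; omega)
    refine ⟨(m i : ℝ)⁻¹ • ∑ u ∈ U, u, _, fun c => ?_,
      hU.isOp (zero_mem_treeSet _ _) (by omega) (by omega) _, .inl rfl, hb⟩
    rw [Finsupp.smul_apply, smul_eq_mul]
    exact mul_nonneg (inv_nonneg.2 (m_pos_real i).le) (hU.sum_nonneg c)
  · have h0 : IsOp S (12 * P.n i) (m i : ℝ)⁻¹ 0 :=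
      ⟨1, fun _ => 0, le_rfl, by omega, fun _ => zero_mem_treeSet _ _, fun a b hab => by omega,
        by simp⟩
    have hheavy : ∀ k ∈ Finset.range (2 * n), |pair φ (x k)| ≤
        C * ((if 2 * t (k / 2) = i then 1 else 0) + δ / 2) := fun k hk =>
      hx.abs_pair_le_of_heavy hφ (by omega) (Finset.mem_range.1 hk)
    by_cases hex : ∃ l < 2 * n, 2 * t (l / 2) = i
    · obtain ⟨l, hl, hli⟩ := hex
      refine ⟨e (2 * (l / 2)).succPNat + e ((2 * (l / 2)).succPNat + 1) + 0, 0, fun c => ?_, h0,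
        .inr (.inr ⟨_, by simp, by simp, rfl⟩),
        abs_pair_sum_le _ _ _ _ fun k hk => (hheavy k hk).trans
          (mul_le_mul_of_nonneg_left (add_le_add_left ?_ _) hC)⟩
      · rw [add_zero]
        exact add_nonneg (e_nonneg _ _) (e_nonneg _ _)
      · rw [add_zero, Finsupp.add_apply]
        have h1 := e_nonneg (2 * (l / 2)).succPNat k.succPNat
        have h2 := e_nonneg ((2 * (l / 2)).succPNat + 1) k.succPNat
        split_ifs with hki
        · have := hx.half_eq (Finset.mem_range.1 hk) hl (hki.trans hli.symm)
          rcases (by omega : k = 2 * (l / 2) ∨ k = 2 * (l / 2) + 1) with h | h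
          · have h3 : e (2 * (l / 2)).succPNat k.succPNat = 1 := by rw [← h, e_apply_self]
            linarith
          · have h3 : (2 * (l / 2)).succPNat + 1 = k.succPNat := by
              rw [h]; rfl
            rw [h3, e_apply_self]
            linarith
        · linarith
    · refine ⟨0, 0, fun c => le_rfl, h0, .inl rfl,
        abs_pair_sum_le _ _ _ _ fun k hk => (hheavy k hk).trans
          (mul_le_mul_of_nonneg_left (le_of_eq ?_) hC)⟩
      rw [if_neg fun h => hex ⟨k, Finset.mem_range.1 hk, h⟩]
      rfl

end Choices
end HIExt

theorem mainTheorem7 (P : HIExt.Choices) (hP : P.Valid) (j : ℕ) (hj : 1 ≤ j) (C : ℝ)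
    (x f : ℕ → HIExt.C00) (hxf : P.IsDependentPaired C j x f) (lam : ℕ → ℝ) :
    (∀ (φ : HIExt.C00) (i : ℕ), P.HasWeight φ i →
      ∃ g₁ g₂ h₁ : HIExt.C00, P.IsMajorant C j x lam φ i g₁ g₂ h₁) ∧
    (∀ j₀ : ℕ,
      (∀ g : HIExt.C00, P.HasWeight g j₀ →
        ∀ a b : ℕ, b ≤ 2 * P.n (2 * j - 1) →
          |HIExt.pair g (∑ k ∈ Finset.Ico a b, lam k • x k)| ≤
            C * ((((Finset.Ico a b).sup fun k => ‖lam k‖₊ : NNReal) : ℝ) +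
              (HIExt.m (2 * j - 1) : ℝ)⁻¹ ^ 3 * ∑ k ∈ Finset.Ico a b, |lam k|)) →
      ∀ (φ : HIExt.C00) (i : ℕ), P.HasWeight φ i → i ≠ j₀ →
        ∃ g₁ g₂ h₁ : HIExt.C00, P.IsMajorant C j x lam φ i g₁ g₂ h₁ ∧
          ∃ (d : ℕ) (child : Fin d → HIExt.FTree),
            (HIExt.FTree.op i child).IsAnalysis (fun r => 12 * P.n r) ∧
            (HIExt.FTree.op i child).value = h₁ ∧
            j₀ ∉ (HIExt.FTree.op i child).weights) := by
  obtain ⟨t, hx⟩ := hxf.isPairedAverages hP hj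
  refine ⟨fun φ i hφ => ?_, fun j₀ hj₀ φ i hφ hi => ?_⟩
  · obtain ⟨g₁, g₂, h₁, h, -⟩ := hx.exists_isMajorant hP (lam := lam) (J := ∅)
      (fun i hi => absurd hi (Set.notMem_empty i)) hφ (Set.notMem_empty i)
    exact ⟨g₁, g₂, h₁, h⟩
  · obtain ⟨g₁, g₂, h₁, h, d, child, h1, h2, h3⟩ := hx.exists_isMajorant hP (lam := lam)
      (J := {j₀}) (fun i hi => by rw [Set.mem_singleton_iff.1 hi]; exact hj₀) hφ hi
    exact ⟨g₁, g₂, h₁, h, d, child, h1, h2, Set.disjoint_singleton_right.1 h3⟩
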